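/- Let $V=\{1,2\}^*$ be the binary tree and let $U^v$, $v\in V$, be independent random variables, uniformly distributed on $[0,1]$. Put $\overline{\mathbb N}_0=\{0,1,2,\dots\}\cup\{\infty\}$. **Comparisons.** Let $X(0,\cdot)=X(1,\cdot)=0$, $X(n,0)=0$ and, for $n\ge 2$, $$(X(n,l))_{l=1}^n\stackrel{\mathcal D}{=}\bigl(n-1+\mathbf 1_{l<I}X^1(I-1,l)+\mathbf 1_{l\ge I}(X^1(I-1,I-1)+X^2(n-I,l-I))\bigr)_{l=1}^n ,$$ where $I$ is uniform on $\{1,\dots,n\}$, $X^1(j,\cdot)$ and $X^2(j,\cdot)$ are distributed as $X(j,\cdot)$, and all these are independent. So $X(n,l)$ is the number of comparisons which Quicksort on the fly needs until the $l$-th smallest of $n$ numbers is published. Let $a(n,l)=E\,X(n,l)$. With $0\ln 0=0$, for $t,x\in[0,1]$, $n\ge1$, $1\le i\le n$ and $1\le l\le n$ put $$C_n(i)=\tfrac1n\bigl(n-1-a(n,n)+a(i-1,i-1)+a(n-i,n-i)\bigr),\qquad C(x)=1+2x\ln x+2(1-x)\ln(1-x),$$ $$C(n,l,i)=\tfrac1n\bigl(n-1-a(n,l)+\mathbf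 1_{l<i}a(i-1,l)+\mathbf 1_{l=i}a(i-1,i-1)+\mathbf 1_{l>i}(a(i-1,i-1)+a(n-i,l-i))\bigr),\qquad C(n,0,i)=0,$$ $$C(t,x)=C(x)+2\cdot\mathbf 1_{t<x}\bigl(-1+x+(1-t)\ln(1-t)-(1-x)\ln(1-x)-(x-t)\ln(x-t)\bigr).$$ **Weighted branching.** A pair $(f,g)$ of a function $f:S\to\mathbb R$ and a map $g:S\to S$ acts on functions $h:S\to\mathbb R$ by $(f,g)\odot h=f\cdot(h\circ g)$; composition of these actions corresponds to $(f_1,g_1)*(f_2,g_2)=(f_1\cdot(f_2\circ g_1),\,g_2\circ g_1)$. Given edge weights $T_i^v$ of this kind and vertex costs $C^v:S\to\mathbb R$, let $L^v_\emptyset=(1,\mathrm{id})$, $L^v_{wi}=L^v_w*T^{vw}_i$, $R^v_m=\sum_{|w|<m}L^v_w\odot C^{vw}$ and $R^v=\lim_{m\to\infty}R^v_m$ (pointwise). **Total cost.** For $n\in\mathbb N$ let $I^v_n=\lceil nU^v\rceil$, $U^v_n=I^v_n/n$, $J^v_1(n)=I_n^v-1$, $J_2^v(n)=n-I_n^v$;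 let $J_i^v(0)=0$ and $J_i^v(\infty)=\infty$. Take $S=\overline{\mathbb N}_0$, with edge weights $(f^v_i,J^v_i)$, where $f^v_i(n)=J^v_i(n)/n$ for $n\in\mathbb N$, $f_i^v(0)=0$, $f^v_1(\infty)=U^v$, $f^v_2(\infty)=1-U^v$, and vertex costs $n\mapsto C_n(I^v_n)$ for $n\in\mathbb N$, $0\mapsto 0$, $\infty\mapsto C(U^v)$. Let $Q^v_n$, $n\in\overline{\mathbb N}_0$, be the resulting limit $R^v(n)$, and $Q^v=Q^v_\infty$. **Processes.** Take $S=[0,1]\times\overline{\mathbb N}_0$, with edge weights $T_i^v=(A_i^v,(B_i^v,J_i^v))$ and vertex costs $C^v$ given for $n\in\mathbb N$ by $$A_1^v(t,n)=\mathbf 1_{t<U_n^v}\tfrac{I_n^v-1}{n},\quad A_2^v(t,n)=\mathbf 1_{t\ge U_n^v}\bigl(1-\tfrac{I_n^v}{n}\bigr),\quad B_1^v(t,n)=1\wedge\tfrac{\lfloor nt\rfloor}{I_n^v-1},\quad B_2^v(t,n)=0\vee\tfrac{t-U_n^v}{1-U_n^v},$$ $$C^v(t,n)=C(n,\lfloor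 nt\rfloor,I_n^v)+\mathbf 1_{t\ge U_n^v}\tfrac{I_n^v-1}{n}Q^{v1}_{I_n^v-1},$$ for $n=\infty$ by $$A_1^v(t,\infty)=\mathbf 1_{t<U^v}U^v,\quad A_2^v(t,\infty)=\mathbf 1_{t\ge U^v}(1-U^v),\quad B_1^v(t,\infty)=1\wedge\tfrac t{U^v},\quad B_2^v(t,\infty)=0\vee\tfrac{t-U^v}{1-U^v},$$ $$C^v(t,\infty)=C(t,U^v)+\mathbf 1_{t\ge U^v}U^vQ^{v1},$$ and by $A_i^v(\cdot,0)=0$, $C^v(\cdot,0)=0$ for $n=0$. (Where a denominator in $B_i^v$ vanishes, $A_i^v=0$ and the value of $B_i^v$ is irrelevant.) Let $R^v(t,n)$ be the resulting limit, and put $Y_n^v(t)=R^v(t,n)$ for finite $n$ and $Y^v(t)=R^v(t,\infty)$; $Y^v$ is the Quicksort process. **Theorem 4.8.** For all $v\in V$ and $n\in\overline{\mathbb N}_0$ the limit defining $Q_n^v$ exists almost surely. For all $v\in V$ and $t\in(0,1]$ and each $n\in\overline{\mathbb N}_0$ the limit defining $R^v(t,n)$ exists almost surely and is square integrable, and $$\|Y_n^v(t)-Y^v(t)\|_2\longrightarrow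 0\qquad(n\to\infty).$$ -/

import Mathlib

open MeasureTheory ProbabilityTheory Filter
open scoped Topology ENNReal

namespace QuicksortProcess

noncomputable section

/-! ### Weighted branching on the binary tree -/

/-- Vertices of the binary tree `{1,2}^*`: finite words, `0 : Fin 2` being the letter `1`
(left child) and `1 : Fin 2` the letter `2` (right child).  The `i`-th child of `v` is
`v ++ [i]`, and the root is `[]`. -/
abbrev Vertex : Type := List (Fin 2)

/-- A pair `(f, g)` of a multiplicative factor `f` and a transformation `g` of the
argument; it stands for the map `h ↦ f * (h ∘ g)` on real functions on `S`. -/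
@[ext]
structure Weight (S : Type) where
  factor : S → ℝ
  move : S → S

namespace Weight

variable {S : Type}

/-- The neutral element `(1, id)`. -/
instance : One (Weight S) := ⟨⟨fun _ => 1, id⟩⟩

/-- `(f₁, g₁) * (f₂, g₂) = (f₁ · (f₂ ∘ g₁), g₂ ∘ g₁)`. -/
instance : Mul (Weight S) :=
  ⟨fun a b => ⟨fun s => a.factor s * b.factor (a.move s), fun s => b.move (a.move s)⟩⟩

/-- The left operation `(f, g) ⊙ h = f · (h ∘ g)`. -/
def act (a : Weight S) (h : S → ℝ) : S → ℝ := fun s => a.factor s * h (a.move s)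

theorem mul_act (a b : Weight S) (h : S → ℝ) : (a * b).act h = a.act (b.act h) := by
  funext s
  exact mul_assoc _ _ _

protected theorem mul_assoc (a b c : Weight S) : a * b * c = a * (b * c) := by
  apply Weight.ext
  · funext s
    exact mul_assoc _ _ _
  · rfl

protected theorem one_mul (a : Weight S) : 1 * a = a := by
  apply Weight.ext
  · funext s
    exact _root_.one_mul _
  · rfl

protected theorem mul_one (a : Weight S) : a * 1 = a := by
  apply Weight.ext
  · funext s
    exact _root_.mul_one _
  · rfl

end Weight

variable {S : Type}

/-- The path weight `L^v_w` along the path from `v` to `v w`, for the weights `T v i` on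
the edges `(v, v i)`. -/
def pathWeight (T : Vertex → Fin 2 → Weight S) : Vertex → List (Fin 2) → Weight S
  | _, [] => 1
  | v, i :: w => T v i * pathWeight T (v ++ [i]) w

/-- The recursion `L^v_{w i} = L^v_w * T_i^{v w}`. -/
theorem pathWeight_append_singleton (T : Vertex → Fin 2 → Weight S) (v : Vertex)
    (w : List (Fin 2)) (i : Fin 2) :
    pathWeight T v (w ++ [i]) = pathWeight T v w * T (v ++ w) i := by
  induction w generalizing v with
  | nil => simp [pathWeight, Weight.one_mul, Weight.mul_one]
  | cons j w ih => simp [pathWeight, ih, Weight.mul_assoc]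

/-- `R_m^v = ∑_{|w| < m} L^v_w ⊙ C^{v w}`. -/
def partialCost (T : Vertex → Fin 2 → Weight S) (C : Vertex → S → ℝ) (m : ℕ) (v : Vertex) :
    S → ℝ :=
  fun s => ∑ k ∈ Finset.range m, ∑ w : Fin k → Fin 2,
    (pathWeight T v (List.ofFn w)).act (C (v ++ List.ofFn w)) s

/-- `R^v = lim_m R_m^v`, pointwise (a meaningful value only where the limit exists). -/
def totalCost (T : Vertex → Fin 2 → Weight S) (C : Vertex → S → ℝ) (v : Vertex) : S → ℝ :=
  fun s => limUnder atTop (fun m : ℕ => partialCost T C m v s)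

/-! ### The number of comparisons and its mean -/

/-- One step of Quicksort on the fly on `n` numbers with pivot rank `I`: `x l` and `y l` are
the numbers of comparisons until the `l`-th smallest number of the left, respectively of
the right, sublist is published. -/
def comparisons (n I : ℕ) (x y : ℕ → ℕ) (l : ℕ) : ℕ :=
  if l = 0 then 0
  else if l < I then n - 1 + x l
  else n - 1 + (x (I - 1) + y (l - I))

/-- The law of `(X(n,l))_l`, where `X(n,l)` is the number of comparisons until the `l`-th
smallest of `n` numbers is published (only `l ≤ n` matters).  For `n ≥ 2` the pivot rank
`I = i + 1` is uniform on `{1,…,n}` and, given `I`, the two sublists of sizes `I - 1` and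
`n - I` are treated independently. -/
def comparisonLaw : ℕ → PMF (ℕ → ℕ)
  | 0 => PMF.pure 0
  | 1 => PMF.pure 0
  | n + 2 =>
    (PMF.uniformOfFintype (Fin (n + 2))).bind fun i =>
      (comparisonLaw i.val).bind fun x =>
        (comparisonLaw (n + 1 - i.val)).map fun y => comparisons (n + 2) (i.val + 1) x y
  termination_by n => n
  decreasing_by
    · exact i.isLt
    · omega

/-- `a(n,l) = E X(n,l)`. -/
def meanComparisons (n l : ℕ) : ℝ :=
  (∑' x : ℕ → ℕ, comparisonLaw n x * (x l : ℝ≥0∞)).toReal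

/-! ### Cost functions -/

/-- `C_n(i) = (n - 1 - a(n,n) + a(i-1,i-1) + a(n-i,n-i)) / n`, and `C_0 = 0`. -/
def rankCost (n i : ℕ) : ℝ :=
  if n = 0 then 0
  else ((n : ℝ) - 1 - meanComparisons n n + meanComparisons (i - 1) (i - 1)
    + meanComparisons (n - i) (n - i)) / n

/-- `C(x) = 1 + 2 x ln x + 2 (1-x) ln (1-x)`. -/
def limitRankCost (x : ℝ) : ℝ :=
  1 + 2 * x * Real.log x + 2 * (1 - x) * Real.log (1 - x)

/-- `C(n,l,i)`, the cost for `n` numbers at time `l` when the pivot has rank `i`. -/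
def timeCost (n l i : ℕ) : ℝ :=
  if n = 0 ∨ l = 0 then 0
  else ((n : ℝ) - 1 - meanComparisons n l
    + (if l < i then meanComparisons (i - 1) l else 0)
    + (if l = i then meanComparisons (i - 1) (i - 1) else 0)
    + (if i < l then meanComparisons (i - 1) (i - 1) + meanComparisons (n - i) (l - i)
        else 0)) / n

/-- `C(t,x)`. -/
def limitTimeCost (t x : ℝ) : ℝ :=
  limitRankCost x
    + 2 * (if t < x then
        -1 + x + (1 - t) * Real.log (1 - t) - (1 - x) * Real.log (1 - x)
          - (x - t) * Real.log (x - t)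
      else 0)

/-! ### The joint embedding

`u v` is the value of the splitting variable `U^v`.  The index `n : ℕ∞` is the length of the
list, `⊤` being the limit. -/

variable (u : Vertex → ℝ)

/-- The rank `I_n^v = ⌈n U^v⌉` of the pivot at `v`. -/
def pivotRank (v : Vertex) (n : ℕ) : ℕ := ⌈(n : ℝ) * u v⌉₊

/-- `U_n^v = I_n^v / n`. -/
def pivotSplit (v : Vertex) (n : ℕ) : ℝ := (pivotRank u v n : ℝ) / n

/-- The lengths `J_1^v(n) = I_n^v - 1`, `J_2^v(n) = n - I_n^v` of the two sublists; for both
`∞ ↦ ∞`. -/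
def sublistSize (v : Vertex) : Fin 2 → ℕ∞ → ℕ∞
  | _, ⊤ => ⊤
  | 0, (n : ℕ) => ((pivotRank u v n - 1 : ℕ) : ℕ∞)
  | 1, (n : ℕ) => ((n - pivotRank u v n : ℕ) : ℕ∞)

/-- Factors of the edge weights for the total cost: `J_i^v(n) / n`, respectively `U^v` and
`1 - U^v` for `n = ∞`. -/
def sizeFactor (v : Vertex) : Fin 2 → ℕ∞ → ℝ
  | 0, ⊤ => u v
  | 1, ⊤ => 1 - u v
  | 0, (n : ℕ) => ((pivotRank u v n - 1 : ℕ) : ℝ) / n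
  | 1, (n : ℕ) => ((n - pivotRank u v n : ℕ) : ℝ) / n

/-- Edge weights on functions of the index alone. -/
def sizeWeight (v : Vertex) (i : Fin 2) : Weight ℕ∞ where
  factor := sizeFactor u v i
  move := sublistSize u v i

/-- Vertex costs on functions of the index alone. -/
def sizeCost (v : Vertex) : ℕ∞ → ℝ
  | ⊤ => limitRankCost (u v)
  | (n : ℕ) => rankCost n (pivotRank u v n)

/-- `Q_n^v` for `n : ℕ`, and `Q^v` for `n = ⊤`. -/
def totalSortCost (v : Vertex) : ℕ∞ → ℝ := totalCost (sizeWeight u) (sizeCost u) v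

/-- `A_i^v(t,n)`. -/
def timeFactor (v : Vertex) : Fin 2 → ℝ → ℕ∞ → ℝ
  | 0, t, ⊤ => if t < u v then u v else 0
  | 1, t, ⊤ => if u v ≤ t then 1 - u v else 0
  | 0, t, (n : ℕ) =>
    if n = 0 then 0
    else if t < pivotSplit u v n then ((pivotRank u v n : ℝ) - 1) / n else 0
  | 1, t, (n : ℕ) =>
    if n = 0 then 0
    else if pivotSplit u v n ≤ t then 1 - (pivotRank u v n : ℝ) / n else 0

/-- `B_i^v(t,n)`; the quotients with denominator `0` come with the factor
`A_i^v(t,n) = 0`. -/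
def timeMove (v : Vertex) : Fin 2 → ℝ → ℕ∞ → ℝ
  | 0, t, ⊤ => min 1 (t / u v)
  | 1, t, ⊤ => max 0 ((t - u v) / (1 - u v))
  | 0, t, (n : ℕ) => min 1 ((⌊(n : ℝ) * t⌋₊ : ℝ) / ((pivotRank u v n : ℝ) - 1))
  | 1, t, (n : ℕ) => max 0 ((t - pivotSplit u v n) / (1 - pivotSplit u v n))

/-- The edge weights `T_i^v = (A_i^v, (B_i^v, J_i^v))`, on functions of `(t, n)` with
`t ∈ [0,1]`. -/
def processWeight (v : Vertex) (i : Fin 2) : Weight (ℝ × ℕ∞) where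
  factor := fun s => timeFactor u v i s.1 s.2
  move := fun s => (timeMove u v i s.1 s.2, sublistSize u v i s.2)

/-- The vertex costs `C^v(t,n)` for a time `t` and an index `n`. -/
def processCostAt (v : Vertex) (t : ℝ) : ℕ∞ → ℝ
  | ⊤ => limitTimeCost t (u v)
      + (if u v ≤ t then u v * totalSortCost u (v ++ [0]) ⊤ else 0)
  | (n : ℕ) =>
    if n = 0 then 0
    else timeCost n ⌊(n : ℝ) * t⌋₊ (pivotRank u v n)
      + (if pivotSplit u v n ≤ t then
          ((pivotRank u v n : ℝ) - 1) / n
            * totalSortCost u (v ++ [0]) ((pivotRank u v n - 1 : ℕ) : ℕ∞)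
        else 0)

/-- The vertex costs `C^v`, as functions of `(t, n)`. -/
def processCost (v : Vertex) : ℝ × ℕ∞ → ℝ := fun s => processCostAt u v s.1 s.2

/-- The partial sums `R_m^v(t,n)`. -/
def processPartial (m : ℕ) (v : Vertex) (t : ℝ) (n : ℕ∞) : ℝ :=
  partialCost (processWeight u) (processCost u) m v (t, n)

/-- `R^v(t,n)`, that is `Y_n^v(t)` for `n : ℕ` and the Quicksort process `Y^v(t)` for
`n = ⊤`. -/
def process (v : Vertex) (t : ℝ) (n : ℕ∞) : ℝ :=
  totalCost (processWeight u) (processCost u) v (t, n)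

end

end QuicksortProcess

/-! Both recursions, for the total cost and for the process, have the same shape: the edge weights
at a vertex depend only on its own label, and the vertex cost depends only on the labels of the
subtree there. Such a `Scheme` is studied on the canonical space of labelled trees, whose law
`treeLaw` is that of a uniform root label joined to two independent subtrees (`map_node`). The
contribution of generation `m + 1` then equals the sum over the two children of a factor times the
contribution of generation `m` in the child's subtree.

Existence. Given the root label `x`, the squared factors add up to at most `x ^ 2 + (1 - x) ^ 2`,
which has mean `2 / 3`. The mixed term of the two branches vanishes, for the total cost because the
costs are centred, for the process because the indicators `t < U` and `t ≥ U` exclude each other.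
Hence generation `m` has `L²` norm at most `κ * rate ^ m` with `rate = √(2/3)`, where `κ` bounds the
`L²` norms of the costs. The generations form a geometrically convergent series, so the partial sums
converge almost surely and in `L²`, with an error bound `tail κ m` that is uniform in the parameter,
in particular in `n` (`Contractive.ae_tendsto_lim`, `Contractive.eLpNorm_psum_sub_lim_le`).

Convergence. Thanks to the uniform tails it suffices that each single generation depends
continuously on the parameter (`Contractive.tendsto_term`, `Contractive.tendsto_lim`). This is an
induction over generations by conditioning on the root label and dominated convergence. As the time
of a child depends on `n`, the induction has to run over all sequences of times and lengths `(τ k, N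
k)` with `τ k → t` and `N k → ∞`, not only over a fixed `t`. The first scheme gives `Q_n → Q` in
`L²`, and this enters the continuity of the vertex costs of the second.

Cost asymptotics. The recursion for the means is solved explicitly: `a(n,l) = sortMean n - restMean
(n - l)`, with both functions given by harmonic numbers (`meanComparisons_eq_sub`). The expansion
`sortMean n = 2 n ln n + sortCoeff n + o(n)` turns the discrete costs into `C(x)` and `C(t,x)`, for
`t > 0` and `x ≠ t`, and bounds them uniformly (`tendsto_timeCost`, `exists_timeCost_le`). -/

namespace QuicksortProcess

/-! ### The law of the labelled tree -/

/-- The uniform distribution on `[0,1]`. -/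
noncomputable def unif : Measure ℝ := volume.restrict (Set.Icc (0 : ℝ) 1)

instance : IsProbabilityMeasure unif := ⟨by simp [unif]⟩

theorem ae_unif_mem_Ioo : ∀ᵐ x ∂unif, x ∈ Set.Ioo (0 : ℝ) 1 := by
  unfold unif
  rw [← Measure.restrict_congr_set (Ioo_ae_eq_Icc (a := (0 : ℝ)) (b := 1))]
  exact ae_restrict_mem measurableSet_Ioo

theorem ae_unif_ne (t : ℝ) : ∀ᵐ x ∂unif, x ≠ t := by
  unfold unif
  exact ae_restrict_of_ae (Measure.ae_ne volume t)

/-- The law of a family of independent uniform variables indexed by the tree. -/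
noncomputable def treeLaw : Measure (Vertex → ℝ) := Measure.infinitePi fun _ => unif

instance : IsProbabilityMeasure treeLaw := by unfold treeLaw; infer_instance

/-- The labelled tree with root label `x` and subtrees `a`, `b`. -/
def node (x : ℝ) (a b : Vertex → ℝ) : Vertex → ℝ
  | [] => x
  | 0 :: w => a w
  | 1 :: w => b w

/-- The subtree at `v`. -/
def subtree (v : Vertex) (u : Vertex → ℝ) : Vertex → ℝ := fun w => u (v ++ w)

@[simp] theorem node_nil (x : ℝ) (a b : Vertex → ℝ) : node x a b [] = x := rfl

theorem measurable_subtree (v : Vertex) : Measurable (subtree v) :=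
  measurable_pi_lambda _ fun _ => measurable_pi_apply _

theorem measurable_node :
    Measurable fun p : ℝ × (Vertex → ℝ) × (Vertex → ℝ) => node p.1 p.2.1 p.2.2 := by
  refine measurable_pi_lambda _ fun w => ?_
  match w with
  | [] => exact measurable_fst
  | 0 :: w => exact (measurable_pi_apply w).comp (measurable_fst.comp measurable_snd)
  | 1 :: w => exact (measurable_pi_apply w).comp (measurable_snd.comp measurable_snd)

/-- A product measure is determined by its values on finite-dimensional boxes. The preimage of a box
under `node` is a product of a set for the root label and one box for each subtree, because every
word is empty or begins with one of the two letters. -/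
theorem map_node :
    (unif.prod (treeLaw.prod treeLaw)).map (fun p => node p.1 p.2.1 p.2.2) = treeLaw := by
  classical
  refine Measure.eq_infinitePi _ fun s t ht => ?_
  have hm : MeasurableSet (Set.pi (s : Set Vertex) t) :=
    MeasurableSet.pi s.countable_toSet fun i _ => ht i
  rw [Measure.map_apply measurable_node hm]
  -- Extending by `Set.univ` lets the root factor be written the same way whether or not the box
  -- constrains the root; an unconstrained root contributes mass `1`.
  set t' : Vertex → Set ℝ := fun i => if i ∈ s then t i else Set.univ with ht'
  have hinj : ∀ i : Fin 2, Function.Injective (fun w : Vertex => i :: w) := fun i =>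
    List.cons_injective
  let c : Fin 2 → Finset Vertex := fun i => s.preimage (fun w => i :: w) ((hinj i).injOn)
  have hpre : (fun p : ℝ × (Vertex → ℝ) × (Vertex → ℝ) => node p.1 p.2.1 p.2.2) ⁻¹'
      (Set.pi (s : Set Vertex) t) =
      t' [] ×ˢ (Set.pi (c 0 : Set Vertex) (fun w => t (0 :: w)) ×ˢ
        Set.pi (c 1 : Set Vertex) (fun w => t (1 :: w))) := by
    ext ⟨x, a, b⟩
    simp only [Set.mem_preimage, Set.mem_pi, Set.mem_prod, c, Finset.coe_preimage, ht']
    constructor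
    · intro h
      refine ⟨?_, fun w hw => h _ hw, fun w hw => h _ hw⟩
      split_ifs with h0
      · exact h [] h0
      · trivial
    · rintro ⟨h0, h1, h2⟩ w hw
      match w, hw with
      | [], hw => simpa [Finset.mem_coe.1 hw] using h0
      | 0 :: w, hw => exact h1 w hw
      | 1 :: w, hw => exact h2 w hw
  rw [hpre, Measure.prod_prod, Measure.prod_prod, treeLaw, Measure.infinitePi_pi _ (fun _ _ => ht _),
    Measure.infinitePi_pi _ (fun _ _ => ht _)]
  have hsplit : s = (s.filter (· = [])) ∪ ((c 0).map ⟨_, hinj 0⟩ ∪ (c 1).map ⟨_, hinj 1⟩) := by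
    ext w
    match w with
    | [] => simp
    | 0 :: w => simp [c]
    | 1 :: w => simp [c]
  conv_rhs => rw [hsplit]
  rw [Finset.prod_union, Finset.prod_union, Finset.prod_map, Finset.prod_map]
  · congr 1
    by_cases h0 : [] ∈ s
    · rw [Finset.prod_filter]
      simp [ht', h0]
    · rw [Finset.prod_filter]
      simp [ht', h0]
  · rw [Finset.disjoint_left]
    simp
  · rw [Finset.disjoint_left]
    intro w hw
    simp at hw
    simp [hw.2]

theorem lintegral_node {F : (Vertex → ℝ) → ℝ≥0∞} (hF : Measurable F) :
    ∫⁻ u, F u ∂treeLaw =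
      ∫⁻ x, ∫⁻ p, F (node x p.1 p.2) ∂(treeLaw.prod treeLaw) ∂unif := by
  conv_lhs => rw [← map_node]
  rw [lintegral_map hF measurable_node]
  exact lintegral_prod _ (hF.comp measurable_node).aemeasurable

theorem integral_node {F : (Vertex → ℝ) → ℝ} (hF : Integrable F treeLaw) :
    ∫ u, F u ∂treeLaw =
      ∫ x, ∫ p, F (node x p.1 p.2) ∂(treeLaw.prod treeLaw) ∂unif := by
  have hF' := hF
  rw [← map_node] at hF'
  conv_lhs => rw [← map_node]
  rw [integral_map measurable_node.aemeasurable hF'.1]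
  exact integral_prod _ (hF'.comp_measurable measurable_node)

/-! ### `L²` norms by conditioning on the root label -/

theorem eLpNorm_two_sq {α : Type*} [MeasurableSpace α] (μ : Measure α) (f : α → ℝ) :
    eLpNorm f 2 μ ^ 2 = ∫⁻ x, ‖f x‖ₑ ^ 2 ∂μ := by
  have h := eLpNorm_nnreal_pow_eq_lintegral (μ := μ) (f := f) (p := 2) two_ne_zero
  simpa using h

theorem eLpNorm_node {F : (Vertex → ℝ) → ℝ} (hF : Measurable F) :
    eLpNorm F 2 treeLaw ^ 2 =
      ∫⁻ x, eLpNorm (fun p : (Vertex → ℝ) × (Vertex → ℝ) => F (node x p.1 p.2)) 2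
        (treeLaw.prod treeLaw) ^ 2 ∂unif := by
  simp only [eLpNorm_two_sq]
  exact lintegral_node (hF.enorm.pow_const 2)

theorem measurable_node_right (x : ℝ) :
    Measurable fun p : (Vertex → ℝ) × (Vertex → ℝ) => node x p.1 p.2 :=
  measurable_node.comp measurable_prodMk_left

theorem eLpNorm_le_of_node {F : (Vertex → ℝ) → ℝ} (hF : Measurable F) {M : ℝ≥0∞}
    (h : ∀ᵐ x ∂unif, eLpNorm (fun p : (Vertex → ℝ) × (Vertex → ℝ) => F (node x p.1 p.2)) 2
      (treeLaw.prod treeLaw) ≤ M) : eLpNorm F 2 treeLaw ≤ M := by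
  rw [← ENNReal.pow_le_pow_left_iff two_ne_zero, eLpNorm_node hF]
  calc _ ≤ ∫⁻ _, M ^ 2 ∂unif := lintegral_mono_ae <| h.mono fun x hx => by gcongr
    _ = M ^ 2 := by simp

/-- Dominated convergence for the squared conditional norms, with the constant `M ^ 2` as majorant.
-/
theorem tendsto_eLpNorm_of_node {F : ℕ → (Vertex → ℝ) → ℝ} (hF : ∀ n, Measurable (F n))
    {M : ℝ≥0∞} (hM : M ≠ ∞)
    (hb : ∀ n, ∀ᵐ x ∂unif,
      eLpNorm (fun p : (Vertex → ℝ) × (Vertex → ℝ) => F n (node x p.1 p.2)) 2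
        (treeLaw.prod treeLaw) ≤ M)
    (h : ∀ᵐ x ∂unif, Tendsto (fun n =>
      eLpNorm (fun p : (Vertex → ℝ) × (Vertex → ℝ) => F n (node x p.1 p.2)) 2
        (treeLaw.prod treeLaw)) atTop (𝓝 0)) :
    Tendsto (fun n => eLpNorm (F n) 2 treeLaw) atTop (𝓝 0) := by
  have hmeas : ∀ n, Measurable fun x =>
      eLpNorm (fun p : (Vertex → ℝ) × (Vertex → ℝ) => F n (node x p.1 p.2)) 2
        (treeLaw.prod treeLaw) ^ 2 := fun n => by
    simp only [eLpNorm_two_sq]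
    exact Measurable.lintegral_prod_right' (f := fun q : ℝ × (Vertex → ℝ) × (Vertex → ℝ) =>
      ‖F n (node q.1 q.2.1 q.2.2)‖ₑ ^ 2)
      (((hF n).comp measurable_node).enorm.pow_const 2)
  have key : Tendsto (fun n => eLpNorm (F n) 2 treeLaw ^ 2) atTop (𝓝 0) := by
    simp only [eLpNorm_node (hF _)]
    have := tendsto_lintegral_of_dominated_convergence (μ := unif) (F := fun n x =>
      eLpNorm (fun p : (Vertex → ℝ) × (Vertex → ℝ) => F n (node x p.1 p.2)) 2
        (treeLaw.prod treeLaw) ^ 2) (f := fun _ => 0) (fun _ => M ^ 2) hmeas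
      (fun n => (hb n).mono fun x hx => by dsimp only; gcongr) (by simp [hM])
      (h.mono fun x hx => by simpa using ENNReal.Tendsto.pow (n := 2) hx)
    simpa using this
  rw [ENNReal.tendsto_nhds_zero] at key ⊢
  intro ε hε
  filter_upwards [key (ε ^ 2) (by positivity)] with n hn
  exact (ENNReal.pow_le_pow_left_iff two_ne_zero).1 hn

/-- The decomposition is `a n * f n - a' * f' = a n * (f n - f') + (a n - a') * f'`. If `a' = 0`,
boundedness of `f n` is enough and no convergence is needed; this covers a branch that disappears in
the limit. -/
theorem tendsto_eLpNorm_mul_sub {α : Type*} [MeasurableSpace α] {μ : Measure α}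
    {a : ℕ → ℝ} {a' : ℝ} {f : ℕ → α → ℝ} {f' : α → ℝ} (hf : ∀ n, Measurable (f n))
    (hf' : Measurable f') {M : ℝ≥0∞} (hM : M ≠ ∞) (hfM : ∀ n, eLpNorm (f n) 2 μ ≤ M)
    (hfM' : eLpNorm f' 2 μ ≤ M) (ha : Tendsto a atTop (𝓝 a'))
    (h : a' = 0 ∨ Tendsto (fun n => eLpNorm (f n - f') 2 μ) atTop (𝓝 0)) :
    Tendsto (fun n => eLpNorm (fun x => a n * f n x - a' * f' x) 2 μ) atTop (𝓝 0) := by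
  have hsub : Tendsto (fun n => ‖a n - a'‖ₑ * M) atTop (𝓝 0) := by
    have h1 : Tendsto (fun n => ‖a n - a'‖ₑ) atTop (𝓝 0) := by
      have := (ha.sub_const a').enorm
      simpa using this
    simpa using ENNReal.Tendsto.mul_const h1 (Or.inr hM)
  rcases h with rfl | h
  · refine tendsto_of_tendsto_of_tendsto_of_le_of_le tendsto_const_nhds hsub
      (fun _ => zero_le) fun n => ?_
    simp only [zero_mul, sub_zero]
    calc eLpNorm (a n • f n) 2 μ = ‖a n‖ₑ * eLpNorm (f n) 2 μ := eLpNorm_const_smul _ _ _ _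
      _ ≤ _ := by gcongr; exact hfM n
  · have h1 : Tendsto (fun n => ‖a n‖ₑ * eLpNorm (f n - f') 2 μ) atTop (𝓝 0) := by
      have := ENNReal.Tendsto.mul ha.enorm (Or.inr ENNReal.zero_ne_top) h (Or.inr enorm_ne_top)
      simpa using this
    have h2 := h1.add hsub
    rw [add_zero] at h2
    refine tendsto_of_tendsto_of_tendsto_of_le_of_le tendsto_const_nhds h2
      (fun _ => zero_le) fun n => ?_
    have : (fun x => a n * f n x - a' * f' x) = a n • (f n - f') + (a n - a') • f' := by
      funext x
      simp only [Pi.add_apply, Pi.smul_apply, Pi.sub_apply, smul_eq_mul]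
      ring
    rw [this]
    refine (eLpNorm_add_le (((hf n).sub hf').const_smul _).aestronglyMeasurable
      (hf'.const_smul _).aestronglyMeasurable one_le_two).trans ?_
    rw [eLpNorm_const_smul, eLpNorm_const_smul]
    gcongr

theorem map_root : treeLaw.map (fun u => u []) = unif :=
  Measure.infinitePi_map_eval _ _

/-! ### Contractive weighted branching -/

/-- A weighted branching scheme whose edge weights at a vertex depend on the label of this vertex,
and whose vertex costs depend on the labels of the subtree at the vertex. -/
structure Scheme (S : Type) [MeasurableSpace S] where
  factor : Fin 2 → S → ℝ → ℝ
  move : Fin 2 → S → ℝ → S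
  cost : S → (Vertex → ℝ) → ℝ
  measurable_factor : ∀ i, Measurable fun p : S × ℝ => factor i p.1 p.2
  measurable_move : ∀ i, Measurable fun p : S × ℝ => move i p.1 p.2
  measurable_cost : Measurable fun p : S × (Vertex → ℝ) => cost p.1 p.2

namespace Scheme

variable {S : Type} [MeasurableSpace S] (B : Scheme S)

/-- The edge weights for the labels `u`. -/
def weight (u : Vertex → ℝ) (v : Vertex) (i : Fin 2) : Weight S where
  factor := fun s => B.factor i s (u v)
  move := fun s => B.move i s (u v)

/-- The vertex costs for the labels `u`. -/
def vertexCost (u : Vertex → ℝ) (v : Vertex) : S → ℝ := fun s => B.cost s (subtree v u)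

/-- The contribution of the `m`-th generation. -/
def term : ℕ → S → (Vertex → ℝ) → ℝ
  | 0, s, u => B.cost s u
  | m + 1, s, u => B.factor 0 s (u []) * term m (B.move 0 s (u [])) (subtree [0] u)
      + B.factor 1 s (u []) * term m (B.move 1 s (u [])) (subtree [1] u)

/-- The contribution of the generations before `m`. -/
def psum (m : ℕ) (s : S) (u : Vertex → ℝ) : ℝ := ∑ k ∈ Finset.range m, B.term k s u

/-- The limit of `psum`, where it exists. -/
noncomputable def lim (s : S) (u : Vertex → ℝ) : ℝ := limUnder atTop fun m => B.psum m s u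

theorem subtree_append (v w : Vertex) (u : Vertex → ℝ) :
    subtree (v ++ w) u = subtree w (subtree v u) := by
  funext x
  simp [subtree]

/-- Splitting words of length `k + 1` at their first letter turns the sum over paths into the
recursion from the root that defines `term`. -/
theorem sum_level_eq_term (u : Vertex → ℝ) (k : ℕ) (v : Vertex) (s : S) :
    ∑ w : Fin k → Fin 2, (pathWeight (B.weight u) v (List.ofFn w)).act
      (B.vertexCost u (v ++ List.ofFn w)) s = B.term k s (subtree v u) := by
  induction k generalizing v s with
  | zero =>
    simp only [Finset.univ_unique, List.ofFn_zero, Finset.sum_singleton, List.append_nil,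
      pathWeight]
    exact one_mul _
  | succ k ih =>
    rw [← (Fin.consEquiv fun _ : Fin (k + 1) => Fin 2).sum_comp, Fintype.sum_prod_type,
      Fin.sum_univ_two]
    have h : ∀ i : Fin 2, ∑ w : Fin k → Fin 2,
        (pathWeight (B.weight u) v (List.ofFn (Fin.consEquiv (fun _ : Fin (k + 1) => Fin 2)
          (i, w)))).act (B.vertexCost u (v ++ List.ofFn (Fin.consEquiv
            (fun _ : Fin (k + 1) => Fin 2) (i, w)))) s =
        B.factor i s (u v) * B.term k (B.move i s (u v)) (subtree [i] (subtree v u)) := by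
      intro i
      rw [← subtree_append, ← ih, Finset.mul_sum]
      refine Finset.sum_congr rfl fun w _ => ?_
      have : List.ofFn (Fin.consEquiv (fun _ : Fin (k + 1) => Fin 2) (i, w)) =
          i :: List.ofFn w := by
        simp [Fin.consEquiv]
      rw [this, pathWeight, Weight.mul_act, List.append_cons v i (List.ofFn w)]
      rfl
    rw [h, h]
    simp [term, subtree]

theorem partialCost_eq_psum (u : Vertex → ℝ) (m : ℕ) (v : Vertex) (s : S) :
    partialCost (B.weight u) (B.vertexCost u) m v s = B.psum m s (subtree v u) :=
  Finset.sum_congr rfl fun k _ => B.sum_level_eq_term u k v s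

theorem totalCost_eq_lim (u : Vertex → ℝ) (v : Vertex) (s : S) :
    totalCost (B.weight u) (B.vertexCost u) v s = B.lim s (subtree v u) := by
  simp only [totalCost, partialCost_eq_psum, lim]

theorem measurable_term (m : ℕ) : Measurable fun p : S × (Vertex → ℝ) => B.term m p.1 p.2 := by
  induction m with
  | zero => exact B.measurable_cost
  | succ m ih =>
    have hroot : Measurable fun p : S × (Vertex → ℝ) => (p.1, p.2 []) :=
      measurable_fst.prodMk ((measurable_pi_apply _).comp measurable_snd)
    have h : ∀ i, Measurable fun p : S × (Vertex → ℝ) =>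
        B.factor i p.1 (p.2 []) * B.term m (B.move i p.1 (p.2 [])) (subtree [i] p.2) := fun i =>
      ((B.measurable_factor i).comp hroot).mul <|
        ih.comp (((B.measurable_move i).comp hroot).prodMk
          ((measurable_subtree _).comp measurable_snd))
    exact (h 0).add (h 1)

theorem measurable_psum (m : ℕ) : Measurable fun p : S × (Vertex → ℝ) => B.psum m p.1 p.2 := by
  unfold psum
  exact Finset.measurable_sum _ fun k _ => B.measurable_term k

/-- Measurability jointly in parameter and labels is needed because the limit is later evaluated at
a random parameter, the length of the left sublist. -/
theorem measurable_lim : Measurable fun p : S × (Vertex → ℝ) => B.lim p.1 p.2 :=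
  (StronglyMeasurable.limUnder (l := atTop) (f := fun m (p : S × (Vertex → ℝ)) =>
    B.psum m p.1 p.2) fun m => (B.measurable_psum m).stronglyMeasurable).measurable

theorem measurable_term_right (m : ℕ) (s : S) : Measurable (B.term m s) :=
  (B.measurable_term m).comp measurable_prodMk_left

theorem measurable_psum_right (m : ℕ) (s : S) : Measurable (B.psum m s) :=
  (B.measurable_psum m).comp measurable_prodMk_left

theorem measurable_lim_right (s : S) : Measurable (B.lim s) := by
  have h : Measurable (Prod.mk s : (Vertex → ℝ) → S × (Vertex → ℝ)) := measurable_prodMk_left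
  have h' := B.measurable_lim.comp h
  exact h'

/-- The weights contract the second moment by the factor `2/3` on the invariant set `A`, the costs
are bounded in `L²`, and different branches are orthogonal. -/
structure Contractive (A : Set S) (κ : ℝ≥0∞) : Prop where
  move_mem : ∀ s ∈ A, ∀ x ∈ Set.Ioo (0 : ℝ) 1, ∀ i, B.move i s x ∈ A
  factor_le : ∀ s ∈ A, ∀ x ∈ Set.Ioo (0 : ℝ) 1,
    B.factor 0 s x ^ 2 + B.factor 1 s x ^ 2 ≤ x ^ 2 + (1 - x) ^ 2
  ne_top : κ ≠ ∞
  cost_le : ∀ s ∈ A, eLpNorm (B.cost s) 2 treeLaw ≤ κ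
  orthogonal : (∀ s ∈ A, ∀ x ∈ Set.Ioo (0 : ℝ) 1, B.factor 0 s x * B.factor 1 s x = 0) ∨
    ∀ s ∈ A, ∫ u, B.cost s u ∂treeLaw = 0

end Scheme

/-! ### Orthogonality of the branches and geometric decay -/

theorem memLp_of_le {α : Type*} [MeasurableSpace α] {μ : Measure α} {f : α → ℝ}
    (hf : Measurable f) {M : ℝ≥0∞} (hM : M ≠ ∞) (h : eLpNorm f 2 μ ≤ M) : MemLp f 2 μ :=
  ⟨hf.aestronglyMeasurable, h.trans_lt hM.lt_top⟩

theorem eLpNorm_sq_eq_ofReal {α : Type*} [MeasurableSpace α] {μ : Measure α} {f : α → ℝ}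
    (hf : MemLp f 2 μ) : eLpNorm f 2 μ ^ 2 = ENNReal.ofReal (∫ x, f x ^ 2 ∂μ) := by
  rw [eLpNorm_two_sq, ofReal_integral_eq_lintegral_ofReal hf.integrable_sq
    (Eventually.of_forall fun x => sq_nonneg _)]
  refine lintegral_congr fun x => ?_
  rw [← Real.enorm_of_nonneg (sq_nonneg _), enorm_pow]

/-- The two coordinates are independent, so the mixed term of the square is `2 * p * q * (∫ f) * (∫
g)`. It vanishes under either alternative of the hypothesis. -/
theorem eLpNorm_orthogonal_le {α : Type*} [MeasurableSpace α] {μ : Measure α}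
    [IsProbabilityMeasure μ] {f g : α → ℝ} (hf : MemLp f 2 μ) (hg : MemLp g 2 μ) {p q : ℝ}
    (h : p * q = 0 ∨ ∫ x, f x ∂μ = 0) {M : ℝ≥0∞} (hfM : eLpNorm f 2 μ ^ 2 ≤ M)
    (hgM : eLpNorm g 2 μ ^ 2 ≤ M) :
    eLpNorm (fun z : α × α => p * f z.1 + q * g z.2) 2 (μ.prod μ) ^ 2
      ≤ ENNReal.ofReal (p ^ 2 + q ^ 2) * M := by
  have hf1 : MemLp (fun z : α × α => f z.1) 2 (μ.prod μ) :=
    hf.comp_measurePreserving measurePreserving_fst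
  have hg1 : MemLp (fun z : α × α => g z.2) 2 (μ.prod μ) :=
    hg.comp_measurePreserving measurePreserving_snd
  have hfi : Integrable f μ := hf.integrable one_le_two
  have hgi : Integrable g μ := hg.integrable one_le_two
  have hsum : MemLp (fun z : α × α => p * f z.1 + q * g z.2) 2 (μ.prod μ) :=
    (hf1.const_mul p).add (hg1.const_mul q)
  rw [eLpNorm_sq_eq_ofReal hsum]
  have hexp : ∫ z, (p * f z.1 + q * g z.2) ^ 2 ∂(μ.prod μ) =
      p ^ 2 * ∫ x, f x ^ 2 ∂μ + q ^ 2 * ∫ x, g x ^ 2 ∂μ := by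
    have h1 : Integrable (fun z : α × α => p ^ 2 * f z.1 ^ 2) (μ.prod μ) :=
      hf1.integrable_sq.const_mul _
    have h2 : Integrable (fun z : α × α => q ^ 2 * g z.2 ^ 2) (μ.prod μ) :=
      hg1.integrable_sq.const_mul _
    have h3 : Integrable (fun z : α × α => 2 * (p * q) * (f z.1 * g z.2)) (μ.prod μ) :=
      (hfi.mul_prod hgi).const_mul _
    have : ∀ z : α × α, (p * f z.1 + q * g z.2) ^ 2 =
        p ^ 2 * f z.1 ^ 2 + 2 * (p * q) * (f z.1 * g z.2) + q ^ 2 * g z.2 ^ 2 := fun z => by ring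
    simp_rw [this]
    have h13 : Integrable (fun z : α × α => p ^ 2 * f z.1 ^ 2 + 2 * (p * q) * (f z.1 * g z.2))
        (μ.prod μ) := h1.add h3
    rw [integral_add h13 h2, integral_add h1 h3, integral_const_mul, integral_const_mul,
      integral_const_mul, integral_prod_mul, integral_fun_fst (fun x => f x ^ 2),
      integral_fun_snd (fun x => g x ^ 2)]
    have h0 : p * q * ∫ x, f x ∂μ = 0 := by
      rcases h with h | h <;> simp [h]
    simp only [probReal_univ, one_smul]
    linear_combination (2 * ∫ x, g x ∂μ) * h0
  rw [hexp, ENNReal.ofReal_add (by positivity) (by positivity), ENNReal.ofReal_mul (sq_nonneg _),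
    ENNReal.ofReal_mul (sq_nonneg _), ← eLpNorm_sq_eq_ofReal hf, ← eLpNorm_sq_eq_ofReal hg,
    ENNReal.ofReal_add (sq_nonneg _) (sq_nonneg _), add_mul]
  gcongr

theorem lintegral_unif_sq :
    ∫⁻ x, ENNReal.ofReal (x ^ 2 + (1 - x) ^ 2) ∂unif = ENNReal.ofReal (2 / 3) := by
  have hc : Continuous fun x : ℝ => x ^ 2 + (1 - x) ^ 2 := by fun_prop
  rw [← ofReal_integral_eq_lintegral_ofReal]
  · congr 1
    rw [unif, integral_Icc_eq_integral_Ioc, ← intervalIntegral.integral_of_le zero_le_one]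
    have : ∀ x : ℝ, x ^ 2 + (1 - x) ^ 2 = 2 * x ^ 2 - 2 * x + 1 := fun x => by ring
    simp_rw [this]
    rw [intervalIntegral.integral_add, intervalIntegral.integral_sub,
      intervalIntegral.integral_const_mul, intervalIntegral.integral_const_mul, integral_pow,
      integral_id]
    · norm_num
    all_goals exact Continuous.intervalIntegrable (by fun_prop) _ _
  · exact hc.continuousOn.integrableOn_compact isCompact_Icc
  · exact Eventually.of_forall fun x => by positivity

namespace Scheme

variable {S : Type} [MeasurableSpace S] {B : Scheme S} {A : Set S} {κ : ℝ≥0∞}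

theorem term_node (m : ℕ) (s : S) (x : ℝ) (a b : Vertex → ℝ) :
    B.term (m + 1) s (node x a b) = B.factor 0 s x * B.term m (B.move 0 s x) a
      + B.factor 1 s x * B.term m (B.move 1 s x) b := rfl

/-- Conditioning on the root label and using orthogonality, one more generation costs a factor `∫ (x
^ 2 + (1 - x) ^ 2) = 2 / 3`. The norm bound and the vanishing mean are proved together, since the
bound for the next generation needs the mean of the present one to vanish when the factors do not
exclude each other. -/
theorem Contractive.eLpNorm_term_sq_le_and (h : B.Contractive A κ) (m : ℕ) : ∀ s ∈ A,
    eLpNorm (B.term m s) 2 treeLaw ^ 2 ≤ κ ^ 2 * ENNReal.ofReal (2 / 3) ^ m ∧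
    ((∀ s ∈ A, ∀ x ∈ Set.Ioo (0 : ℝ) 1, B.factor 0 s x * B.factor 1 s x = 0) ∨
      ∫ u, B.term m s u ∂treeLaw = 0) := by
  induction m with
  | zero =>
    intro s hs
    refine ⟨?_, h.orthogonal.imp_right fun h' => h' s hs⟩
    simpa [term] using pow_le_pow_left' (h.cost_le s hs) 2
  | succ m ih =>
    intro s hs
    set M := κ ^ 2 * ENNReal.ofReal (2 / 3) ^ m with hM
    have hMtop : M ≠ ∞ :=
      ENNReal.mul_ne_top (ENNReal.pow_ne_top h.ne_top) (ENNReal.pow_ne_top ENNReal.ofReal_ne_top)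
    have hmem : ∀ t ∈ A, MemLp (B.term m t) 2 treeLaw := fun t ht => by
      refine ⟨(B.measurable_term_right m t).aestronglyMeasurable, lt_top_iff_ne_top.2 fun htop => ?_⟩
      have := (ih t ht).1
      rw [htop] at this
      simp only [ne_eq, OfNat.ofNat_ne_zero, not_false_eq_true, ENNReal.top_pow, top_le_iff] at this
      exact hMtop this
    have hle : eLpNorm (B.term (m + 1) s) 2 treeLaw ^ 2 ≤
        κ ^ 2 * ENNReal.ofReal (2 / 3) ^ (m + 1) := by
      rw [eLpNorm_node (B.measurable_term_right _ s)]
      calc _ ≤ ∫⁻ x, ENNReal.ofReal (x ^ 2 + (1 - x) ^ 2) * M ∂unif := by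
            refine lintegral_mono_ae (ae_unif_mem_Ioo.mono fun x hx => ?_)
            have h0 := h.move_mem s hs x hx 0
            have h1 := h.move_mem s hs x hx 1
            simp only [term_node]
            refine (eLpNorm_orthogonal_le (hmem _ h0) (hmem _ h1) ?_ (ih _ h0).1
              (ih _ h1).1).trans ?_
            · exact (ih _ h0).2.imp_left fun h' => h' s hs x hx
            · exact mul_le_mul' (ENNReal.ofReal_le_ofReal (h.factor_le s hs x hx)) le_rfl
        _ = _ := by
            rw [lintegral_mul_const' _ _ hMtop, lintegral_unif_sq, hM, pow_succ]
            ring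
    refine ⟨hle, ?_⟩
    -- Without mutually exclusive factors, the mean of the next generation given the root label is a
    -- linear combination of two means that vanish by induction.
    by_cases hcase : ∀ s ∈ A, ∀ x ∈ Set.Ioo (0 : ℝ) 1, B.factor 0 s x * B.factor 1 s x = 0
    · exact Or.inl hcase
    right
    have hmem' : MemLp (B.term (m + 1) s) 2 treeLaw := by
      refine ⟨(B.measurable_term_right _ s).aestronglyMeasurable,
        lt_top_iff_ne_top.2 fun htop => ?_⟩
      rw [htop] at hle
      simp only [ne_eq, OfNat.ofNat_ne_zero, not_false_eq_true, ENNReal.top_pow, top_le_iff] at hle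
      exact ENNReal.mul_ne_top (ENNReal.pow_ne_top h.ne_top)
        (ENNReal.pow_ne_top ENNReal.ofReal_ne_top) hle
    rw [integral_node (hmem'.integrable one_le_two)]
    refine integral_eq_zero_of_ae (ae_unif_mem_Ioo.mono fun x hx => ?_)
    have h0 := h.move_mem s hs x hx 0
    have h1 := h.move_mem s hs x hx 1
    simp only [term_node, Pi.zero_apply]
    have hi0 := (hmem _ h0).integrable one_le_two
    have hi1 := (hmem _ h1).integrable one_le_two
    rw [integral_add ((hi0.comp_fst _).const_mul _) ((hi1.comp_snd _).const_mul _),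
      integral_const_mul, integral_const_mul, integral_fun_fst (B.term m _),
      integral_fun_snd (B.term m _), ((ih _ h0).2.resolve_left hcase),
      ((ih _ h1).2.resolve_left hcase)]
    simp

/-- The rate of contraction of the `L²` norms. -/
noncomputable def rate : ℝ≥0∞ := ENNReal.ofReal (√(2 / 3))

theorem rate_sq : rate ^ 2 = ENNReal.ofReal (2 / 3) := by
  rw [rate, ← ENNReal.ofReal_pow (Real.sqrt_nonneg _), Real.sq_sqrt (by norm_num)]

theorem rate_lt_one : rate < 1 := by
  rw [rate, ENNReal.ofReal_lt_one, Real.sqrt_lt' one_pos]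
  norm_num

theorem rate_ne_zero : rate ≠ 0 := by
  rw [rate, Ne, ENNReal.ofReal_eq_zero, not_le]
  positivity

theorem Contractive.eLpNorm_term_le (h : B.Contractive A κ) (m : ℕ) {s : S} (hs : s ∈ A) :
    eLpNorm (B.term m s) 2 treeLaw ≤ κ * rate ^ m := by
  rw [← ENNReal.pow_le_pow_left_iff two_ne_zero, mul_pow, ← pow_mul, mul_comm m, pow_mul, rate_sq]
  exact (h.eLpNorm_term_sq_le_and m s hs).1

/-- A bound for the `L²` distance between a partial sum and the limit. -/
noncomputable def tail (κ : ℝ≥0∞) (m : ℕ) : ℝ≥0∞ := (κ * (1 - rate)⁻¹ + 1) * rate ^ m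

theorem tail_const_ne_top (hκ : κ ≠ ∞) : κ * (1 - rate)⁻¹ + 1 ≠ ∞ :=
  ENNReal.add_ne_top.2 ⟨ENNReal.mul_ne_top hκ
    (ENNReal.inv_ne_top.2 (tsub_pos_of_lt rate_lt_one).ne'), ENNReal.one_ne_top⟩

theorem tsum_tail_ne_top (hκ : κ ≠ ∞) : ∑' m, tail κ m ≠ ∞ := by
  simp only [tail]
  rw [ENNReal.tsum_mul_left, ENNReal.tsum_geometric]
  exact ENNReal.mul_ne_top (tail_const_ne_top hκ)
    (ENNReal.inv_ne_top.2 (tsub_pos_of_lt rate_lt_one).ne')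

theorem tendsto_tail (hκ : κ ≠ ∞) : Tendsto (tail κ) atTop (𝓝 0) := by
  have := ENNReal.Tendsto.const_mul (ENNReal.tendsto_pow_atTop_nhds_zero_of_lt_one rate_lt_one)
    (Or.inr (tail_const_ne_top hκ))
  rw [mul_zero] at this
  exact this

/-- The difference is a block of generations from `N` on, bounded by a geometric series. Different
generations need not be orthogonal; the triangle inequality suffices. -/
theorem Contractive.eLpNorm_psum_sub_lt (h : B.Contractive A κ) {s : S} (hs : s ∈ A)
    {N n m : ℕ} (hn : N ≤ n) (hm : N ≤ m) :
    eLpNorm (B.psum n s - B.psum m s) 2 treeLaw < tail κ N := by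
  wlog hnm : m ≤ n generalizing n m
  · rw [← eLpNorm_neg, neg_sub]
    exact this hm hn (le_of_not_ge hnm)
  have heq : B.psum n s - B.psum m s = ∑ k ∈ Finset.Ico m n, B.term k s := by
    funext u
    simp only [psum, Pi.sub_apply, Finset.sum_apply]
    exact (Finset.sum_Ico_eq_sub _ hnm).symm
  rw [heq]
  have hpos : rate ^ N ≠ 0 := pow_ne_zero _ rate_ne_zero
  have hfin : rate ^ N ≠ ∞ := ENNReal.pow_ne_top rate_lt_one.ne_top
  calc _ ≤ ∑ k ∈ Finset.Ico m n, eLpNorm (B.term k s) 2 treeLaw :=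
        eLpNorm_sum_le (fun k _ => (B.measurable_term_right k s).aestronglyMeasurable) one_le_two
    _ ≤ ∑ k ∈ Finset.Ico m n, κ * rate ^ k :=
        Finset.sum_le_sum fun k _ => h.eLpNorm_term_le k hs
    _ ≤ ∑ k ∈ Finset.Ico N n, κ * rate ^ k :=
        Finset.sum_le_sum_of_subset (Finset.Ico_subset_Ico_left hm)
    _ = κ * (∑ k ∈ Finset.range (n - N), rate ^ k) * rate ^ N := by
        rw [Finset.sum_Ico_eq_sum_range, Finset.mul_sum, Finset.sum_mul]
        exact Finset.sum_congr rfl fun k _ => by ring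
    _ ≤ κ * (1 - rate)⁻¹ * rate ^ N := by
        gcongr
        rw [← ENNReal.tsum_geometric]
        exact ENNReal.sum_le_tsum _
    _ < tail κ N := by
        -- The summand `1` in the constant of `tail` makes the inequality strict, as the Cauchy
        -- criterion for almost sure convergence demands.
        rw [tail, add_mul, one_mul]
        refine ENNReal.lt_add_right (ENNReal.mul_ne_top ?_ hfin) hpos
        exact (ENNReal.add_ne_top.1 (tail_const_ne_top h.ne_top)).1

theorem Contractive.ae_tendsto_lim (h : B.Contractive A κ) {s : S} (hs : s ∈ A) :
    ∀ᵐ u ∂treeLaw, Tendsto (fun m => B.psum m s u) atTop (𝓝 (B.lim s u)) := by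
  have := Lp.ae_tendsto_of_cauchy_eLpNorm (μ := treeLaw) (p := 2) (f := fun m => B.psum m s)
    (fun m => (B.measurable_psum_right m s).aestronglyMeasurable) one_le_two
    (tsum_tail_ne_top h.ne_top) fun N n m hn hm => h.eLpNorm_psum_sub_lt hs hn hm
  exact this.mono fun u hu => tendsto_nhds_limUnder hu

/-- Fatou's lemma: for fixed `m`, the differences `psum m - psum n` converge almost surely as `n →
∞` and are eventually bounded by `tail κ m`. -/
theorem Contractive.eLpNorm_psum_sub_lim_le (h : B.Contractive A κ) {s : S} (hs : s ∈ A) (m : ℕ) :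
    eLpNorm (B.psum m s - B.lim s) 2 treeLaw ≤ tail κ m := by
  refine (Lp.eLpNorm_lim_le_liminf_eLpNorm (μ := treeLaw)
    (f := fun n => B.psum m s - B.psum n s)
    (fun n => ((B.measurable_psum_right m s).sub
      (B.measurable_psum_right n s)).aestronglyMeasurable) (B.psum m s - B.lim s)
    ((h.ae_tendsto_lim hs).mono fun u hu => tendsto_const_nhds.sub hu)).trans ?_
  refine liminf_le_of_frequently_le' (Eventually.frequently ?_)
  filter_upwards [eventually_ge_atTop m] with n hn
  exact (h.eLpNorm_psum_sub_lt hs le_rfl hn).le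

theorem Contractive.eLpNorm_lim_le (h : B.Contractive A κ) {s : S} (hs : s ∈ A) :
    eLpNorm (B.lim s) 2 treeLaw ≤ tail κ 0 := by
  have h0 := h.eLpNorm_psum_sub_lim_le hs 0
  have : B.psum 0 s - B.lim s = -B.lim s := by
    funext u
    simp [psum]
  rwa [this, eLpNorm_neg] at h0

theorem tail_ne_top (hκ : κ ≠ ∞) (m : ℕ) : tail κ m ≠ ∞ :=
  ENNReal.ne_top_of_tsum_ne_top (tsum_tail_ne_top hκ) m

theorem Contractive.memLp_lim (h : B.Contractive A κ) {s : S} (hs : s ∈ A) :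
    MemLp (B.lim s) 2 treeLaw :=
  memLp_of_le (B.measurable_lim_right s) (tail_ne_top h.ne_top 0) (h.eLpNorm_lim_le hs)

/-! ### Continuous dependence on the parameter -/

/-- A relation `Conv σ s` of convergence of parameters that is inherited by the subtrees and under
which the costs converge in `L²`. -/
structure Continuous (B : Scheme S) (A : Set S) (Conv : (ℕ → S) → S → Prop) : Prop where
  mem : ∀ {σ s}, Conv σ s → s ∈ A ∧ ∀ n, σ n ∈ A
  factor : ∀ {σ s}, Conv σ s → ∀ᵐ x ∂unif, ∀ i,
    Tendsto (fun n => B.factor i (σ n) x) atTop (𝓝 (B.factor i s x))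
  move : ∀ {σ s}, Conv σ s → ∀ᵐ x ∂unif, ∀ i,
    B.factor i s x = 0 ∨ Conv (fun n => B.move i (σ n) x) (B.move i s x)
  cost : ∀ {σ s}, Conv σ s →
    Tendsto (fun n => eLpNorm (B.cost (σ n) - B.cost s) 2 treeLaw) atTop (𝓝 0)

theorem Contractive.abs_factor_le (h : B.Contractive A κ) {s : S} (hs : s ∈ A) {x : ℝ}
    (hx : x ∈ Set.Ioo (0 : ℝ) 1) (i : Fin 2) : |B.factor i s x| ≤ 1 := by
  rw [← sq_le_one_iff_abs_le_one]
  have h1 := h.factor_le s hs x hx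
  have h2 : x ^ 2 + (1 - x) ^ 2 ≤ 1 := by nlinarith [hx.1, hx.2]
  fin_cases i
  · change B.factor 0 s x ^ 2 ≤ 1
    nlinarith [sq_nonneg (B.factor 1 s x)]
  · change B.factor 1 s x ^ 2 ≤ 1
    nlinarith [sq_nonneg (B.factor 0 s x)]

theorem Contractive.eLpNorm_factor_mul_term_le (h : B.Contractive A κ) {s t : S} (hs : s ∈ A)
    (ht : t ∈ A) {x : ℝ} (hx : x ∈ Set.Ioo (0 : ℝ) 1) (i : Fin 2) (m : ℕ) :
    eLpNorm (fun a => B.factor i s x * B.term m t a) 2 treeLaw ≤ κ * rate ^ m := by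
  calc eLpNorm (B.factor i s x • B.term m t) 2 treeLaw
      = ‖B.factor i s x‖ₑ * eLpNorm (B.term m t) 2 treeLaw := eLpNorm_const_smul _ _ _ _
    _ ≤ 1 * (κ * rate ^ m) := by
        gcongr
        · rw [← enorm_one (G := ℝ), enorm_le_iff_norm_le]
          simpa using h.abs_factor_le hs hx i
        · exact h.eLpNorm_term_le m ht
    _ = _ := one_mul _

/-- Given the root label, the difference splits into one difference of products per branch. The
induction hypothesis applies to the moved parameters, which again converge unless the limiting
factor is zero. -/
theorem Contractive.tendsto_term (h : B.Contractive A κ) {Conv : (ℕ → S) → S → Prop}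
    (hc : B.Continuous A Conv) (m : ℕ) : ∀ {σ s}, Conv σ s →
    Tendsto (fun n => eLpNorm (B.term m (σ n) - B.term m s) 2 treeLaw) atTop (𝓝 0) := by
  induction m with
  | zero => exact fun hσ => hc.cost hσ
  | succ m ih =>
    intro σ s hσ
    obtain ⟨hs, hσA⟩ := hc.mem hσ
    set M := κ * rate ^ m with hM
    have hMtop : M ≠ ∞ := ENNReal.mul_ne_top h.ne_top (ENNReal.pow_ne_top rate_lt_one.ne_top)
    let d : Fin 2 → ℝ → ℕ → (Vertex → ℝ) → ℝ := fun i x n a =>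
      B.factor i (σ n) x * B.term m (B.move i (σ n) x) a
        - B.factor i s x * B.term m (B.move i s x) a
    have hdm : ∀ i x n, Measurable (d i x n) := fun i x n =>
      ((B.measurable_term_right m _).const_mul _).sub ((B.measurable_term_right m _).const_mul _)
    have hnode : ∀ x n, (fun p : (Vertex → ℝ) × (Vertex → ℝ) =>
        (B.term (m + 1) (σ n) - B.term (m + 1) s) (node x p.1 p.2)) =
        (fun p => d 0 x n p.1) + fun p => d 1 x n p.2 := by
      intro x n
      funext p
      simp only [Pi.sub_apply, term_node, Pi.add_apply, d]
      ring
    have hsplit : ∀ x n, eLpNorm (fun p : (Vertex → ℝ) × (Vertex → ℝ) =>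
        (B.term (m + 1) (σ n) - B.term (m + 1) s) (node x p.1 p.2)) 2 (treeLaw.prod treeLaw) ≤
        eLpNorm (d 0 x n) 2 treeLaw + eLpNorm (d 1 x n) 2 treeLaw := by
      intro x n
      rw [hnode]
      refine (eLpNorm_add_le ((hdm 0 x n).comp measurable_fst).aestronglyMeasurable
        ((hdm 1 x n).comp measurable_snd).aestronglyMeasurable one_le_two).trans_eq ?_
      congr 1
      · exact eLpNorm_comp_measurePreserving (hdm 0 x n).aestronglyMeasurable
          measurePreserving_fst
      · exact eLpNorm_comp_measurePreserving (hdm 1 x n).aestronglyMeasurable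
          measurePreserving_snd
    refine tendsto_eLpNorm_of_node (M := (M + M) + (M + M))
      (fun n => (B.measurable_term_right _ _).sub (B.measurable_term_right _ _))
      (by simp [hMtop]) (fun n => ?_) ?_
    · refine ae_unif_mem_Ioo.mono fun x hx => (hsplit x n).trans ?_
      have hd : ∀ i, eLpNorm (d i x n) 2 treeLaw ≤ M + M := fun i =>
        (eLpNorm_sub_le ((B.measurable_term_right m _).const_mul _).aestronglyMeasurable
          ((B.measurable_term_right m _).const_mul _).aestronglyMeasurable one_le_two).trans
          (add_le_add
            (h.eLpNorm_factor_mul_term_le (hσA n) (h.move_mem _ (hσA n) x hx i) hx i m)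
            (h.eLpNorm_factor_mul_term_le hs (h.move_mem _ hs x hx i) hx i m))
      exact add_le_add (hd 0) (hd 1)
    · filter_upwards [ae_unif_mem_Ioo, hc.factor hσ, hc.move hσ] with x hx hfac hmove
      have hd : ∀ i, Tendsto (fun n => eLpNorm (d i x n) 2 treeLaw) atTop (𝓝 0) := fun i =>
        tendsto_eLpNorm_mul_sub (fun n => B.measurable_term_right m _)
          (B.measurable_term_right m _) hMtop
          (fun n => h.eLpNorm_term_le m (h.move_mem _ (hσA n) x hx i))
          (h.eLpNorm_term_le m (h.move_mem _ hs x hx i)) (hfac i)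
          ((hmove i).imp_right fun h' => ih h')
      have := (hd 0).add (hd 1)
      rw [add_zero] at this
      exact tendsto_of_tendsto_of_tendsto_of_le_of_le tendsto_const_nhds this
        (fun _ => zero_le) (hsplit x)

theorem Contractive.tendsto_psum (h : B.Contractive A κ) {Conv : (ℕ → S) → S → Prop}
    (hc : B.Continuous A Conv) (m : ℕ) {σ s} (hσ : Conv σ s) :
    Tendsto (fun n => eLpNorm (B.psum m (σ n) - B.psum m s) 2 treeLaw) atTop (𝓝 0) := by
  have hsum : Tendsto (fun n => ∑ k ∈ Finset.range m,
      eLpNorm (B.term k (σ n) - B.term k s) 2 treeLaw) atTop (𝓝 0) := by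
    have := tendsto_finsetSum (Finset.range m) fun k _ => h.tendsto_term hc k hσ
    simpa using this
  refine tendsto_of_tendsto_of_tendsto_of_le_of_le tendsto_const_nhds hsum
    (fun _ => zero_le) fun n => ?_
  have : B.psum m (σ n) - B.psum m s = ∑ k ∈ Finset.range m, (B.term k (σ n) - B.term k s) := by
    funext u
    simp [psum]
  dsimp only
  rw [this]
  exact eLpNorm_sum_le (fun k _ => ((B.measurable_term_right k _).sub
    (B.measurable_term_right k _)).aestronglyMeasurable) one_le_two

/-- Three-epsilon argument: one generation count `m` makes both tails small for all parameters in
`A`, and then finitely many generations converge. -/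
theorem Contractive.tendsto_lim (h : B.Contractive A κ) {Conv : (ℕ → S) → S → Prop}
    (hc : B.Continuous A Conv) {σ s} (hσ : Conv σ s) :
    Tendsto (fun n => eLpNorm (B.lim (σ n) - B.lim s) 2 treeLaw) atTop (𝓝 0) := by
  obtain ⟨hs, hσA⟩ := hc.mem hσ
  rw [ENNReal.tendsto_nhds_zero]
  intro ε hε
  have hε3 : 0 < ε / 3 := ENNReal.div_pos hε.ne' (by simp)
  obtain ⟨m, hm⟩ := ((ENNReal.tendsto_nhds_zero.1 (tendsto_tail h.ne_top)) (ε / 3) hε3).exists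
  filter_upwards [(ENNReal.tendsto_nhds_zero.1 (h.tendsto_psum hc m hσ)) (ε / 3) hε3] with n hn
  have heq : B.lim (σ n) - B.lim s = -(B.psum m (σ n) - B.lim (σ n)) +
      ((B.psum m (σ n) - B.psum m s) + (B.psum m s - B.lim s)) := by
    abel
  have hmp := fun t => B.measurable_psum_right m t
  have hml := fun t => B.measurable_lim_right t
  rw [heq]
  calc _ ≤ eLpNorm (-(B.psum m (σ n) - B.lim (σ n))) 2 treeLaw +
        eLpNorm ((B.psum m (σ n) - B.psum m s) + (B.psum m s - B.lim s)) 2 treeLaw :=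
        eLpNorm_add_le ((hmp _).sub (hml _)).neg.aestronglyMeasurable
          (((hmp _).sub (hmp _)).add ((hmp _).sub (hml _))).aestronglyMeasurable one_le_two
    _ ≤ ε / 3 + (ε / 3 + ε / 3) := by
        rw [eLpNorm_neg]
        refine add_le_add ((h.eLpNorm_psum_sub_lim_le (hσA n) m).trans hm) ?_
        exact (eLpNorm_add_le ((hmp _).sub (hmp _)).aestronglyMeasurable
          ((hmp _).sub (hml _)).aestronglyMeasurable one_le_two).trans
          (add_le_add hn ((h.eLpNorm_psum_sub_lim_le hs m).trans hm))
    _ = ε := by rw [← add_assoc, ENNReal.add_thirds]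

end Scheme

/-! ### The mean number of comparisons -/

/-- The expectation of `g` under `p`. -/
noncomputable def expect {α : Type*} (p : PMF α) (g : α → ℝ≥0∞) : ℝ≥0∞ := ∑' x, p x * g x

section expect

variable {α β : Type*}

theorem expect_pure (a : α) (g : α → ℝ≥0∞) : expect (PMF.pure a) g = g a := by
  classical
  rw [expect, tsum_eq_single a]
  · simp
  · intro b hb
    simp [PMF.pure_apply, hb]

theorem expect_bind (p : PMF α) (k : α → PMF β) (g : β → ℝ≥0∞) :
    expect (p.bind k) g = expect p fun a => expect (k a) g := by
  simp only [expect, PMF.bind_apply, ← ENNReal.tsum_mul_right, ← ENNReal.tsum_mul_left]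
  rw [ENNReal.tsum_comm]
  exact tsum_congr fun a => tsum_congr fun b => mul_assoc _ _ _

theorem expect_map (p : PMF α) (f : α → β) (g : β → ℝ≥0∞) :
    expect (p.map f) g = expect p fun a => g (f a) := by
  rw [PMF.map, expect_bind]
  simp [expect_pure]

theorem expect_const (p : PMF α) (c : ℝ≥0∞) : expect p (fun _ => c) = c := by
  rw [expect, ENNReal.tsum_mul_right, p.tsum_coe, one_mul]

theorem expect_add (p : PMF α) (g h : α → ℝ≥0∞) :
    expect p (fun x => g x + h x) = expect p g + expect p h := by
  simp only [expect, mul_add]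
  exact ENNReal.tsum_add

theorem expect_uniformOfFintype [Fintype α] [Nonempty α] (g : α → ℝ≥0∞) :
    expect (PMF.uniformOfFintype α) g = (Fintype.card α : ℝ≥0∞)⁻¹ * ∑ x, g x := by
  simp [expect, tsum_fintype, Finset.mul_sum]

end expect

/-- `E X(n,l)` in `[0,∞]`. -/
noncomputable def emean (n l : ℕ) : ℝ≥0∞ := expect (comparisonLaw n) fun x => (x l : ℝ≥0∞)

theorem meanComparisons_eq (n l : ℕ) : meanComparisons n l = (emean n l).toReal := rfl

theorem emean_zero_left (l : ℕ) : emean 0 l = 0 := by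
  simp [emean, comparisonLaw, expect_pure]

theorem emean_one_left (l : ℕ) : emean 1 l = 0 := by
  simp [emean, comparisonLaw, expect_pure]

theorem emean_add_two (n l : ℕ) : emean (n + 2) l =
    ((n + 2 : ℕ) : ℝ≥0∞)⁻¹ * ∑ i ∈ Finset.range (n + 2),
      expect (comparisonLaw i) fun x => expect (comparisonLaw (n + 1 - i)) fun y =>
        (comparisons (n + 2) (i + 1) x y l : ℝ≥0∞) := by
  rw [emean, comparisonLaw, expect_bind, expect_uniformOfFintype, Fintype.card_fin,
    Finset.sum_range]
  simp only [expect_bind, expect_map]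

theorem emean_zero_right (n : ℕ) : emean n 0 = 0 := by
  match n with
  | 0 => exact emean_zero_left 0
  | 1 => exact emean_one_left 0
  | n + 2 =>
    rw [emean_add_two]
    simp [comparisons, expect_const]

/-- The index `i` is the pivot rank minus one. If the pivot itself is the `l`-th smallest number,
that is `l = i + 1`, the second mean is taken at time `0` and vanishes. -/
theorem emean_add_two_of_pos (n l : ℕ) (hl : l ≠ 0) : emean (n + 2) l =
    ((n + 2 : ℕ) : ℝ≥0∞)⁻¹ * ∑ i ∈ Finset.range (n + 2), ((n + 1 : ℕ) +
      if l ≤ i then emean i l else emean i i + emean (n + 1 - i) (l - (i + 1))) := by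
  rw [emean_add_two]
  congr 1
  refine Finset.sum_congr rfl fun i _ => ?_
  by_cases h : l ≤ i
  · have h' : l < i + 1 := by omega
    simp only [comparisons, hl, h', h, if_true, if_false, expect_const, Nat.cast_add (n + 2 - 1),
      expect_add]
    rfl
  · have h' : ¬ l < i + 1 := by omega
    have hcast : ∀ a b : ℕ, ((n + 2 - 1 + (a + b) : ℕ) : ℝ≥0∞) = ((n + 1 : ℕ) : ℝ≥0∞) + (a + b) :=
      fun a b => by push_cast; rfl
    simp only [comparisons, hl, h', h, if_false, hcast, expect_add, expect_const]
    rfl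

/-- Finiteness is what allows the recursion in `[0,∞]` to be transferred to the real means. -/
theorem emean_ne_top (n l : ℕ) : emean n l ≠ ∞ := by
  induction n using Nat.strong_induction_on generalizing l with
  | _ n ih =>
    match n with
    | 0 => simp [emean_zero_left]
    | 1 => simp [emean_one_left]
    | n + 2 =>
      by_cases hl : l = 0
      · simp [hl, emean_zero_right]
      rw [emean_add_two_of_pos n l hl]
      refine ENNReal.mul_ne_top (by simp) (ENNReal.sum_ne_top.2 fun i hi => ?_)
      have hi' := Finset.mem_range.1 hi
      refine ENNReal.add_ne_top.2 ⟨ENNReal.natCast_ne_top _, ?_⟩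
      split_ifs
      · exact ih i hi' l
      · exact ENNReal.add_ne_top.2 ⟨ih i hi' i, ih _ (by omega) _⟩

theorem meanComparisons_zero_left (l : ℕ) : meanComparisons 0 l = 0 := by
  simp [meanComparisons_eq, emean_zero_left]

theorem meanComparisons_zero_right (n : ℕ) : meanComparisons n 0 = 0 := by
  simp [meanComparisons_eq, emean_zero_right]

theorem mul_meanComparisons (n l : ℕ) (hl : l ≠ 0) :
    (n : ℝ) * meanComparisons n l = n * (n - 1) + ∑ i ∈ Finset.range n,
      if l ≤ i then meanComparisons i l
      else meanComparisons i i + meanComparisons (n - 1 - i) (l - (i + 1)) := by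
  match n with
  | 0 => simp
  | 1 => simp [meanComparisons_eq, emean_zero_left, emean_one_left, hl]
  | n + 2 =>
    have hterm : ∀ i, ((n + 1 : ℕ) +
      if l ≤ i then emean i l else emean i i + emean (n + 1 - i) (l - (i + 1))) ≠ ∞ := by
      intro i
      refine ENNReal.add_ne_top.2 ⟨ENNReal.natCast_ne_top _, ?_⟩
      split_ifs
      · exact emean_ne_top _ _
      · exact ENNReal.add_ne_top.2 ⟨emean_ne_top _ _, emean_ne_top _ _⟩
    rw [meanComparisons_eq, emean_add_two_of_pos n l hl, ENNReal.toReal_mul,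
      ENNReal.toReal_sum fun i _ => hterm i, ENNReal.toReal_inv, ENNReal.toReal_natCast,
      mul_inv_cancel_left₀ (by positivity)]
    have : ∀ i, ((n + 1 : ℕ) + if l ≤ i then emean i l
        else emean i i + emean (n + 1 - i) (l - (i + 1))).toReal = ((n : ℝ) + 1) +
        if l ≤ i then meanComparisons i l
        else meanComparisons i i + meanComparisons (n + 2 - 1 - i) (l - (i + 1)) := by
      intro i
      split_ifs
      · rw [ENNReal.toReal_add (ENNReal.natCast_ne_top _) (emean_ne_top _ _),
          ENNReal.toReal_natCast, meanComparisons_eq]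
        push_cast
        rfl
      · rw [ENNReal.toReal_add (ENNReal.natCast_ne_top _)
          (ENNReal.add_ne_top.2 ⟨emean_ne_top _ _, emean_ne_top _ _⟩),
          ENNReal.toReal_add (emean_ne_top _ _) (emean_ne_top _ _), ENNReal.toReal_natCast,
          meanComparisons_eq, meanComparisons_eq]
        push_cast
        rfl
    simp only [this, Finset.sum_add_distrib, Finset.sum_const, Finset.card_range, nsmul_eq_mul]
    push_cast
    ring

/-! ### Closed form of the means -/

/-- The mean number of comparisons that Quicksort needs for `n` numbers. -/
noncomputable def sortMean (n : ℕ) : ℝ := 2 * (n + 1) * (harmonic n : ℝ) - 4 * n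

/-- The mean number of comparisons that are still needed when `k` numbers are unpublished. -/
noncomputable def restMean (k : ℕ) : ℝ :=
  sortMean k - 2 * k - 4 + 4 * (harmonic (k + 1) : ℝ)

theorem cast_harmonic_succ (n : ℕ) :
    (harmonic (n + 1) : ℝ) = (harmonic n : ℝ) + 1 / ((n : ℝ) + 1) := by
  rw [harmonic_succ]
  push_cast
  rw [one_div]

@[simp] theorem sortMean_zero : sortMean 0 = 0 := by simp [sortMean]

@[simp] theorem restMean_zero : restMean 0 = 0 := by
  simp [restMean]

theorem mul_sortMean (n : ℕ) :
    (n : ℝ) * sortMean n = n * (n - 1) + 2 * ∑ j ∈ Finset.range n, sortMean j := by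
  induction n with
  | zero => simp
  | succ n ih =>
    rw [Finset.sum_range_succ, mul_add, ← add_assoc]
    have : 2 * ∑ j ∈ Finset.range n, sortMean j = n * sortMean n - n * (n - 1) := by linarith
    rw [add_assoc, this]
    simp only [sortMean, cast_harmonic_succ]
    push_cast
    field_simp
    ring

/-- Inserting `a(n,l) = sortMean n - restMean (n - l)` into the recursion for the means leaves
exactly this identity with `k = n - l`; all terms that depend on `l` otherwise cancel. -/
theorem mul_restMean (k : ℕ) : ((k : ℝ) + 1) * restMean k =
    sortMean k + ∑ j ∈ Finset.range k, (sortMean j + restMean j) := by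
  induction k with
  | zero => simp
  | succ k ih =>
    rw [Finset.sum_range_succ]
    have : ∑ j ∈ Finset.range k, (sortMean j + restMean j) =
      (k + 1) * restMean k - sortMean k := by linarith
    rw [this]
    simp only [restMean, sortMean, cast_harmonic_succ]
    push_cast
    field_simp
    ring

theorem meanComparisons_eq_sub (n l : ℕ) (hl : l ≠ 0) (hln : l ≤ n) :
    meanComparisons n l = sortMean n - restMean (n - l) := by
  induction n using Nat.strong_induction_on generalizing l with
  | _ n ih =>
    obtain ⟨l, rfl⟩ := Nat.exists_eq_succ_of_ne_zero hl
    obtain ⟨k, rfl⟩ := Nat.exists_eq_add_of_le hln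
    have hself : ∀ i < l.succ + k, meanComparisons i i = sortMean i := by
      intro i hi
      rcases Nat.eq_zero_or_pos i with rfl | h
      · simp [meanComparisons_zero_left]
      · rw [ih i hi i h.ne' le_rfl]
        simp
    have hpos : ((l.succ + k : ℕ) : ℝ) ≠ 0 := by positivity
    refine mul_left_cancel₀ hpos ?_
    rw [mul_meanComparisons _ _ hl, Nat.add_sub_cancel_left,
      mul_sub _ (sortMean _), mul_sortMean]
    -- The pivots are split into those before the published number, the published number itself, and
    -- those after it. In the first case `k` numbers remain unpublished in the right sublist; in the
    -- last, `i` remain unpublished in the left one.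
    have hsum : ∑ i ∈ Finset.range (l.succ + k), (if l.succ ≤ i then meanComparisons i l.succ
        else meanComparisons i i + meanComparisons (l.succ + k - 1 - i) (l.succ - (i + 1))) =
        ∑ i ∈ Finset.range (l.succ + k), sortMean i
        + ∑ i ∈ Finset.range l, (sortMean (k + 1 + i) - restMean k)
        - ∑ i ∈ Finset.range k, restMean i := by
      rw [Finset.sum_range_add, Finset.sum_range_add, Finset.sum_range_succ,
        Finset.sum_range_succ, ← Finset.sum_range_reflect (fun i => sortMean (k + 1 + i) - _)]
      have h1 : ∀ i ∈ Finset.range l, (if l.succ ≤ i then meanComparisons i l.succ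
          else meanComparisons i i + meanComparisons (l.succ + k - 1 - i) (l.succ - (i + 1))) =
          sortMean i + (sortMean (k + 1 + (l - 1 - i)) - restMean k) := by
        intro i hi
        have hi' := Finset.mem_range.1 hi
        rw [if_neg (by omega), hself i (by omega), ih _ (by omega) _ (by omega) (by omega)]
        congr 3 <;> omega
      have h2 : ∀ i ∈ Finset.range k, (if l.succ ≤ l.succ + i then
          meanComparisons (l.succ + i) l.succ
          else meanComparisons (l.succ + i) (l.succ + i) +
            meanComparisons (l.succ + k - 1 - (l.succ + i)) (l.succ - (l.succ + i + 1))) =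
          sortMean (l.succ + i) - restMean i := by
        intro i hi
        have hi' := Finset.mem_range.1 hi
        rw [if_pos (by omega), ih _ (by omega) _ hl (by omega)]
        congr 2
        omega
      rw [Finset.sum_congr rfl h1, Finset.sum_congr rfl h2, if_neg (by omega), Nat.sub_self,
        meanComparisons_zero_right, hself l (by omega)]
      simp only [Finset.sum_add_distrib, Finset.sum_sub_distrib]
      ring
    rw [hsum, Finset.sum_sub_distrib]
    have hs : ∑ i ∈ Finset.range (l.succ + k), sortMean i =
        ∑ i ∈ Finset.range k, sortMean i + sortMean k
          + ∑ i ∈ Finset.range l, sortMean (k + 1 + i) := by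
      rw [show l.succ + k = k + 1 + l by omega, Finset.sum_range_add, Finset.sum_range_succ]
    have hr := mul_restMean k
    rw [Finset.sum_add_distrib] at hr
    simp only [Finset.sum_const, Finset.card_range, nsmul_eq_mul]
    push_cast
    linear_combination -hs + hr

theorem meanComparisons_self (n : ℕ) : meanComparisons n n = sortMean n := by
  rcases Nat.eq_zero_or_pos n with rfl | h
  · simp [meanComparisons_zero_left]
  · rw [meanComparisons_eq_sub n n h.ne' le_rfl]
    simp

theorem rankCost_eq (n i : ℕ) (hn : n ≠ 0) : rankCost n i =
    ((n : ℝ) - 1 - sortMean n + sortMean (i - 1) + sortMean (n - i)) / n := by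
  simp only [rankCost, hn, if_false, meanComparisons_self]

/-- If the pivot precedes the `l`-th number, both the whole list and the right sublist have `n - l`
unpublished numbers, so the two values of `restMean` cancel and only the rank cost is left. -/
theorem timeCost_eq (n l i : ℕ) (hl : l ≠ 0) (hln : l ≤ n) (hi : i ≠ 0) (hin : i ≤ n) :
    timeCost n l i = rankCost n i + if i < l then 0
      else if i = l then (restMean (n - i) - sortMean (n - i)) / n
      else (restMean (n - l) - restMean (i - 1 - l) - sortMean (n - i)) / n := by
  have hn : n ≠ 0 := by omega
  rw [rankCost_eq n i hn, timeCost, if_neg (by omega), meanComparisons_eq_sub n l hl hln,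
    meanComparisons_self]
  rcases lt_trichotomy l i with h | h | h
  · rw [if_pos h, if_neg h.ne, if_neg (by omega), if_neg (by omega), if_neg (by omega),
      meanComparisons_eq_sub _ l hl (by omega)]
    ring
  · subst h
    simp only [lt_irrefl, if_true, if_false]
    ring
  · rw [if_neg (by omega), if_neg (by omega), if_pos h, if_pos h,
      meanComparisons_eq_sub _ _ (by omega) (by omega), show n - i - (l - i) = n - l by omega]
    ring

/-- This is the Quicksort recursion `mul_sortMean`; it expresses that the costs are centred under a
uniform pivot rank. -/
theorem sum_rankCost (n : ℕ) : ∑ i ∈ Finset.range n, rankCost n (i + 1) = 0 := by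
  rcases Nat.eq_zero_or_pos n with rfl | h
  · simp
  simp only [rankCost_eq n _ h.ne', Nat.add_sub_cancel]
  rw [← Finset.sum_div, Finset.sum_add_distrib, Finset.sum_add_distrib]
  have hrefl : ∑ i ∈ Finset.range n, sortMean (n - (i + 1)) =
      ∑ i ∈ Finset.range n, sortMean i := by
    rw [← Finset.sum_range_reflect sortMean]
    exact Finset.sum_congr rfl fun i _ => by rw [Nat.sub_sub, add_comm 1 i]
  rw [hrefl]
  simp only [Finset.sum_const, Finset.card_range, nsmul_eq_mul]
  rw [div_eq_zero_iff]
  left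
  linear_combination -mul_sortMean n

/-! ### Asymptotics of the costs -/

section negligible

open Asymptotics

/-- The constant `K` absorbs the finitely many small arguments, so the bound is valid for all `p`,
including sublist lengths that do not grow. -/
theorem exists_abs_le_mul_add {e : ℕ → ℝ} (he : e =o[atTop] fun n : ℕ => (n : ℝ)) {ε : ℝ}
    (hε : 0 < ε) : ∃ K, 0 ≤ K ∧ ∀ p : ℕ, |e p| ≤ ε * p + K := by
  obtain ⟨P, hP⟩ := eventually_atTop.1 (he.bound hε)
  refine ⟨∑ p ∈ Finset.range P, |e p|, Finset.sum_nonneg fun _ _ => abs_nonneg _, fun p => ?_⟩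
  rcases le_or_gt P p with h | h
  · have := hP p h
    simp only [Real.norm_eq_abs, Nat.abs_cast] at this
    have : 0 ≤ ∑ p ∈ Finset.range P, |e p| := Finset.sum_nonneg fun _ _ => abs_nonneg _
    linarith
  · have h1 := Finset.single_le_sum (f := fun p => |e p|) (fun _ _ => abs_nonneg _)
      (Finset.mem_range.2 h)
    have h2 : 0 ≤ ε * (p : ℝ) := by positivity
    linarith

theorem exists_abs_div_le {e : ℕ → ℝ} (he : e =o[atTop] fun n : ℕ => (n : ℝ)) :
    ∃ K, ∀ p n : ℕ, n ≠ 0 → p ≤ n → |e p / n| ≤ K := by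
  obtain ⟨K, hK0, hK⟩ := exists_abs_le_mul_add he one_pos
  refine ⟨1 + K, fun p n hn hp => ?_⟩
  have hn1 : (1 : ℝ) ≤ n := by exact_mod_cast Nat.one_le_iff_ne_zero.2 hn
  have hpn : (p : ℝ) ≤ n := by exact_mod_cast hp
  rw [abs_div, Nat.abs_cast, div_le_iff₀ (by linarith)]
  nlinarith [hK p]

theorem tendsto_negligible_div {e : ℕ → ℝ} (he : e =o[atTop] fun n : ℕ => (n : ℝ))
    {p N : ℕ → ℕ} (hN : Tendsto N atTop atTop) (hp : ∀ᶠ k in atTop, p k ≤ N k) :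
    Tendsto (fun k => e (p k) / N k) atTop (𝓝 0) := by
  rw [Metric.tendsto_nhds]
  intro ε hε
  obtain ⟨K, hK0, hK⟩ := exists_abs_le_mul_add he (half_pos hε)
  have hNr : Tendsto (fun k => (N k : ℝ)) atTop atTop := tendsto_natCast_atTop_atTop.comp hN
  filter_upwards [hp, hNr.eventually_gt_atTop (2 * K / ε), hNr.eventually_gt_atTop 0] with
    k hk hk1 hk2
  rw [Real.dist_eq, sub_zero, abs_div, Nat.abs_cast, div_lt_iff₀ hk2]
  rw [div_lt_iff₀ hε] at hk1
  have hpn : (p k : ℝ) ≤ N k := by exact_mod_cast hk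
  nlinarith [hK (p k)]

theorem one_negligible : (fun _ : ℕ => (1 : ℝ)) =o[atTop] fun n : ℕ => (n : ℝ) := by
  rw [isLittleO_const_left]
  right
  simpa [Function.comp_def] using tendsto_natCast_atTop_atTop (R := ℝ)

theorem const_negligible (c : ℝ) : (fun _ : ℕ => c) =o[atTop] fun n : ℕ => (n : ℝ) := by
  simpa using one_negligible.const_mul_left c

theorem log_negligible : (fun n : ℕ => Real.log n) =o[atTop] fun n : ℕ => (n : ℝ) :=
  Real.isLittleO_log_id_atTop.comp_tendsto tendsto_natCast_atTop_atTop

theorem harmonic_negligible : (fun n : ℕ => (harmonic n : ℝ)) =o[atTop] fun n : ℕ => (n : ℝ) := by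
  have h := (Real.tendsto_harmonic_sub_log.isBigO_one ℝ).trans_isLittleO one_negligible
  simpa using h.add log_negligible

theorem harmonic_succ_negligible :
    (fun n : ℕ => (harmonic (n + 1) : ℝ)) =o[atTop] fun n : ℕ => (n : ℝ) := by
  have h : (fun n : ℕ => 1 / ((n : ℝ) + 1)) =o[atTop] fun n : ℕ => (n : ℝ) :=
    (tendsto_one_div_add_atTop_nhds_zero_nat.isBigO_one ℝ).trans_isLittleO one_negligible
  simpa [cast_harmonic_succ] using harmonic_negligible.add h

end negligible

/-! ### Expansion of the means up to `o(n)` -/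

/-- The coefficient of `n` in the expansion of `sortMean n`. -/
noncomputable def sortCoeff : ℝ := 2 * Real.eulerMascheroniConstant - 4

/-- The remainder in `sortMean n = 2 n ln n + sortCoeff n + o(n)`. -/
noncomputable def sortRem (n : ℕ) : ℝ := sortMean n - 2 * (n * Real.log n) - sortCoeff * n

theorem sortRem_negligible : sortRem =o[atTop] fun n : ℕ => (n : ℝ) := by
  have h1 : (fun n : ℕ => (harmonic n : ℝ) - Real.log n - Real.eulerMascheroniConstant)
      =o[atTop] fun _ => (1 : ℝ) := by
    rw [Asymptotics.isLittleO_one_iff]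
    simpa using Real.tendsto_harmonic_sub_log.sub_const Real.eulerMascheroniConstant
  have h2 : (fun n : ℕ => (n : ℝ) *
      ((harmonic n : ℝ) - Real.log n - Real.eulerMascheroniConstant)) =o[atTop]
      fun n : ℕ => (n : ℝ) := by
    simpa using (Asymptotics.isBigO_refl (fun n : ℕ => (n : ℝ)) atTop).mul_isLittleO h1
  refine ((h2.const_mul_left 2).add (harmonic_negligible.const_mul_left 2)).congr_left fun n => ?_
  simp only [sortRem, sortMean, sortCoeff]
  ring

/-- `sortMean p / n`, up to a multiple of `p / n`. -/
noncomputable def scaledMean (p n : ℕ) : ℝ :=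
  sortMean p / n - (2 * Real.log n + sortCoeff) * (p / n)

/-- Since `ln p = ln n + ln (p / n)`, subtracting the part linear in `p` leaves the scale-free
function `2 x ln x` at `x = p / n`, also for `p = 0` because `0 ln 0 = 0`. -/
theorem scaledMean_eq (p n : ℕ) (hn : n ≠ 0) : scaledMean p n =
    2 * ((p / n : ℝ) * Real.log (p / n)) + sortRem p / n := by
  have hn' : (n : ℝ) ≠ 0 := by exact_mod_cast hn
  rcases Nat.eq_zero_or_pos p with rfl | hp
  · simp [scaledMean, sortRem]
  have hp' : (p : ℝ) ≠ 0 := by positivity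
  rw [Real.log_div hp' hn', scaledMean, sortRem]
  field_simp
  ring

theorem exists_scaledMean_le : ∃ K, ∀ p n : ℕ, n ≠ 0 → p ≤ n → |scaledMean p n| ≤ K := by
  obtain ⟨K, hK⟩ := exists_abs_div_le sortRem_negligible
  obtain ⟨K', hK'⟩ := (isCompact_Icc (a := (0 : ℝ)) (b := 1)).exists_bound_of_continuousOn
    Real.continuous_mul_log.continuousOn
  refine ⟨2 * K' + K, fun p n hn hp => ?_⟩
  have hn' : (0 : ℝ) < n := by positivity
  have hmem : (p / n : ℝ) ∈ Set.Icc (0 : ℝ) 1 :=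
    ⟨by positivity, (div_le_one hn').2 (by exact_mod_cast hp)⟩
  rw [scaledMean_eq p n hn]
  refine (abs_add_le _ _).trans (add_le_add ?_ (hK p n hn hp))
  rw [abs_mul, abs_two]
  have := hK' _ hmem
  rw [Real.norm_eq_abs] at this
  linarith

theorem tendsto_scaledMean {p N : ℕ → ℕ} {x : ℝ} (hN : Tendsto N atTop atTop)
    (hp : ∀ᶠ k in atTop, p k ≤ N k)
    (hx : Tendsto (fun k => (p k / N k : ℝ)) atTop (𝓝 x)) :
    Tendsto (fun k => scaledMean (p k) (N k)) atTop (𝓝 (2 * (x * Real.log x))) := by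
  have h1 := ((Real.continuous_mul_log.tendsto x).comp hx).const_mul 2
  have h2 := h1.add (tendsto_negligible_div sortRem_negligible hN hp)
  rw [add_zero] at h2
  refine h2.congr' ?_
  filter_upwards [hN.eventually_ne_atTop 0] with k hk
  rw [scaledMean_eq _ _ hk]
  rfl

/-- The logarithmic correction that is due to the comparisons with the pivot. -/
noncomputable def logCorrection (n : ℕ) : ℝ := 2 * Real.log n + sortCoeff

theorem logCorrection_negligible : logCorrection =o[atTop] fun n : ℕ => (n : ℝ) :=
  (log_negligible.const_mul_left 2).add (const_negligible sortCoeff)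

/-- The remainder in `restMean n = sortMean n - 2 n + o(n)`. -/
noncomputable def restRem (n : ℕ) : ℝ := -4 + 4 * (harmonic (n + 1) : ℝ)

theorem restRem_negligible : restRem =o[atTop] fun n : ℕ => (n : ℝ) :=
  (const_negligible _).add (harmonic_succ_negligible.const_mul_left 4)

theorem restMean_eq (n : ℕ) : restMean n = sortMean n - 2 * n + restRem n := by
  rw [restMean, restRem]
  ring

/-- The subtracted linear parts nearly cancel, as the sublists have total length `n - 1`; the
missing pivot leaves the single term `logCorrection n / n`. -/
theorem rankCost_eq_scaled (n i : ℕ) (hi : i ≠ 0) (hin : i ≤ n) : rankCost n i =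
    ((n : ℝ) - 1) / n - scaledMean n n + scaledMean (i - 1) n + scaledMean (n - i) n
      - logCorrection n / n := by
  have hn : n ≠ 0 := by omega
  have hn' : (n : ℝ) ≠ 0 := by exact_mod_cast hn
  rw [rankCost_eq n i hn]
  simp only [scaledMean, logCorrection]
  rw [Nat.cast_sub hin, Nat.cast_sub (Nat.one_le_iff_ne_zero.2 hi)]
  field_simp
  push_cast
  ring

/-- Here `(n - l) - (i - 1 - l) - (n - i) = 1`, so again one `logCorrection n / n` remains. The
linear terms `- 2 k` of `restMean k` add up to `- 2 (n - i + 1)`, the source of `- 1 + x` in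
`C(t,x)`. -/
theorem timeCost_eq_scaled (n l i : ℕ) (hl : l ≠ 0) (hli : l < i) (hin : i ≤ n) :
    timeCost n l i = rankCost n i + (scaledMean (n - l) n - scaledMean (i - 1 - l) n
      - scaledMean (n - i) n + logCorrection n / n + restRem (n - l) / n
      - restRem (i - 1 - l) / n - 2 * (((n - i : ℕ) + 1 : ℝ) / n)) := by
  have hn : n ≠ 0 := by omega
  have hn' : (n : ℝ) ≠ 0 := by exact_mod_cast hn
  rw [timeCost_eq n l i hl (by omega) (by omega) hin, if_neg (by omega), if_neg (by omega),
    restMean_eq, restMean_eq]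
  simp only [scaledMean, logCorrection]
  rw [Nat.cast_sub hin, Nat.cast_sub (show l ≤ n by omega), Nat.cast_sub (show l ≤ i - 1 by omega),
    Nat.cast_sub (show 1 ≤ i by omega)]
  field_simp
  push_cast
  ring

theorem exists_rankCost_le : ∃ K, ∀ n i : ℕ, i ≠ 0 → i ≤ n → |rankCost n i| ≤ K := by
  obtain ⟨K, hK⟩ := exists_scaledMean_le
  obtain ⟨K', hK'⟩ := exists_abs_div_le logCorrection_negligible
  refine ⟨1 + K + K + K + K', fun n i hi hin => ?_⟩
  have hn : n ≠ 0 := by omega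
  have hn1 : (1 : ℝ) ≤ n := by exact_mod_cast Nat.one_le_iff_ne_zero.2 hn
  rw [rankCost_eq_scaled n i hi hin]
  have h0 : |((n : ℝ) - 1) / n| ≤ 1 := by
    rw [abs_of_nonneg (div_nonneg (by linarith) (by linarith)), div_le_one (by linarith)]
    linarith
  have h1 := hK n n hn le_rfl
  have h2 := hK (i - 1) n hn (by omega)
  have h3 := hK (n - i) n hn (by omega)
  have h4 := hK' n n hn le_rfl
  rw [abs_le] at *
  constructor <;> linarith [h0.1, h0.2, h1.1, h1.2, h2.1, h2.2, h3.1, h3.2, h4.1, h4.2]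

theorem exists_timeCost_le : ∃ K, ∀ n l i : ℕ, l ≤ n → i ≠ 0 → i ≤ n → |timeCost n l i| ≤ K := by
  obtain ⟨K₀, hK₀⟩ := exists_rankCost_le
  obtain ⟨K, hK⟩ := exists_scaledMean_le
  obtain ⟨K', hK'⟩ := exists_abs_div_le logCorrection_negligible
  obtain ⟨L, hL⟩ := exists_abs_div_le restRem_negligible
  have hK0 : 0 ≤ K := (abs_nonneg _).trans (hK 0 1 one_ne_zero zero_le_one)
  have hK'0 : 0 ≤ K' := (abs_nonneg _).trans (hK' 0 1 one_ne_zero zero_le_one)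
  have hL0 : 0 ≤ L := (abs_nonneg _).trans (hL 0 1 one_ne_zero zero_le_one)
  have hK₀0 : 0 ≤ K₀ := (abs_nonneg _).trans (hK₀ 1 1 one_ne_zero le_rfl)
  refine ⟨K₀ + (K + K + K + K' + L + L + 2), fun n l i hln hi hin => ?_⟩
  have hn : n ≠ 0 := by omega
  have hn1 : (0 : ℝ) < n := by positivity
  have hr := hK₀ n i hi hin
  rcases Nat.eq_zero_or_pos l with rfl | hl
  · simp only [timeCost, or_true, if_true, abs_zero]
    linarith
  rcases lt_or_ge l i with h | h
  · rw [timeCost_eq_scaled n l i hl.ne' h hin]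
    have h0 : |((n - i : ℕ) + 1 : ℝ) / n| ≤ 1 := by
      rw [abs_of_nonneg (by positivity), div_le_one hn1]
      have : n - i + 1 ≤ n := by omega
      exact_mod_cast this
    have h1 := hK (n - l) n hn (by omega)
    have h2 := hK (i - 1 - l) n hn (by omega)
    have h3 := hK (n - i) n hn (by omega)
    have h4 := hK' n n hn le_rfl
    have h5 := hL (n - l) n hn (by omega)
    have h6 := hL (i - 1 - l) n hn (by omega)
    rw [abs_le] at *
    constructor <;> linarith [h0.1, h0.2, h1.1, h1.2, h2.1, h2.2, h3.1, h3.2, h4.1, h4.2, h5.1,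
      h5.2, h6.1, h6.2, hr.1, hr.2]
  · rw [timeCost_eq n l i hl.ne' hln hi hin]
    rcases h.lt_or_eq with h | h
    · rw [if_pos h, add_zero]
      linarith
    · rw [if_neg (by omega), if_pos h, restMean_eq]
      have h0 : |((n - i : ℕ) : ℝ) / n| ≤ 1 := by
        rw [abs_of_nonneg (by positivity), div_le_one hn1]
        exact_mod_cast Nat.sub_le n i
      have h5 := hL (n - i) n hn (by omega)
      have : (sortMean (n - i) - 2 * ((n - i : ℕ) : ℝ) + restRem (n - i) - sortMean (n - i)) / n =
          restRem (n - i) / n - 2 * (((n - i : ℕ) : ℝ) / n) := by ring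
      rw [this]
      rw [abs_le] at *
      constructor <;> linarith [h0.1, h0.2, h5.1, h5.2, hr.1, hr.2]

/-! ### Convergence and boundedness of the costs -/

theorem tendsto_cast_sub_div {p q N : ℕ → ℕ} {x y : ℝ} (hpq : ∀ᶠ k in atTop, q k ≤ p k)
    (hp : Tendsto (fun k => (p k / N k : ℝ)) atTop (𝓝 x))
    (hq : Tendsto (fun k => (q k / N k : ℝ)) atTop (𝓝 y)) :
    Tendsto (fun k => ((p k - q k : ℕ) / N k : ℝ)) atTop (𝓝 (x - y)) := by
  refine (hp.sub hq).congr' ?_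
  filter_upwards [hpq] with k hk
  rw [Nat.cast_sub hk]
  ring

theorem tendsto_self_div {N : ℕ → ℕ} (hN : Tendsto N atTop atTop) :
    Tendsto (fun k => (N k / N k : ℝ)) atTop (𝓝 1) := by
  refine tendsto_const_nhds.congr' ?_
  filter_upwards [hN.eventually_ne_atTop 0] with k hk
  rw [div_self]
  exact_mod_cast hk

theorem tendsto_one_div_nat {N : ℕ → ℕ} (hN : Tendsto N atTop atTop) :
    Tendsto (fun k => (((fun _ => 1 : ℕ → ℕ) k : ℕ) / N k : ℝ)) atTop (𝓝 0) := by
  simpa [Function.comp_def] using (tendsto_inv_atTop_nhds_zero_nat (𝕜 := ℝ)).comp hN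

theorem tendsto_rankCost {N i : ℕ → ℕ} {x : ℝ} (hN : Tendsto N atTop atTop)
    (hi : ∀ᶠ k in atTop, i k ≠ 0 ∧ i k ≤ N k)
    (hx : Tendsto (fun k => (i k / N k : ℝ)) atTop (𝓝 x)) :
    Tendsto (fun k => rankCost (N k) (i k)) atTop (𝓝 (limitRankCost x)) := by
  have h1 := tendsto_scaledMean (p := N) hN (Eventually.of_forall fun _ => le_rfl)
    (tendsto_self_div hN)
  have h2 := tendsto_scaledMean (p := fun k => i k - 1) hN
    (hi.mono fun k hk => (Nat.sub_le _ _).trans hk.2)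
    (tendsto_cast_sub_div (hi.mono fun k hk => Nat.one_le_iff_ne_zero.2 hk.1) hx
      (tendsto_one_div_nat hN))
  have h3 := tendsto_scaledMean (p := fun k => N k - i k) hN
    (Eventually.of_forall fun k => Nat.sub_le _ _)
    (tendsto_cast_sub_div (hi.mono fun k hk => hk.2) (tendsto_self_div hN) hx)
  have h4 := tendsto_negligible_div logCorrection_negligible (p := N) hN
    (Eventually.of_forall fun _ => le_rfl)
  have h5 : Tendsto (fun k => ((N k : ℝ) - 1) / N k) atTop (𝓝 1) := by
    have := (tendsto_self_div hN).sub (tendsto_one_div_nat hN)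
    simp only [Nat.cast_one, sub_zero] at this
    exact this.congr fun k => (sub_div _ _ _).symm
  have h := (((h5.sub h1).add h2).add h3).sub h4
  have hlim : 1 - 2 * (1 * Real.log 1) + 2 * ((x - 0) * Real.log (x - 0)) +
      2 * ((1 - x) * Real.log (1 - x)) - 0 = limitRankCost x := by
    simp only [limitRankCost, Real.log_one, sub_zero]
    ring
  rw [hlim] at h
  refine h.congr' ?_
  filter_upwards [hi] with k hk
  rw [rankCost_eq_scaled _ _ hk.1 hk.2]

theorem tendsto_timeCost {N l i : ℕ → ℕ} {t x : ℝ} (hN : Tendsto N atTop atTop)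
    (hi : ∀ᶠ k in atTop, i k ≠ 0 ∧ i k ≤ N k)
    (hx : Tendsto (fun k => (i k / N k : ℝ)) atTop (𝓝 x)) (hl : ∀ᶠ k in atTop, l k ≤ N k)
    (ht : Tendsto (fun k => (l k / N k : ℝ)) atTop (𝓝 t)) (ht0 : 0 < t) (hxt : x ≠ t) :
    Tendsto (fun k => timeCost (N k) (l k) (i k)) atTop (𝓝 (limitTimeCost t x)) := by
  have hr := tendsto_rankCost hN hi hx
  -- Positivity of `t` is essential: the cost at `l = 0` is `0` by convention, whereas `C(0,x) = 2 x
  -- - 1` for `0 < x`.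
  have hlpos : ∀ᶠ k in atTop, l k ≠ 0 := by
    filter_upwards [ht.eventually_const_lt ht0] with k hk h0
    simp [h0] at hk
  have hNpos : ∀ᶠ k in atTop, (0 : ℝ) < N k := by
    filter_upwards [hN.eventually_gt_atTop 0] with k hk
    exact_mod_cast hk
  rcases lt_or_gt_of_ne hxt with h | h
  · have hlim : limitTimeCost t x = limitRankCost x := by
      rw [limitTimeCost, if_neg h.le.not_gt]
      ring
    rw [hlim]
    refine hr.congr' ?_
    filter_upwards [hi, hl, hlpos, hx.eventually_lt ht h, hNpos] with k hik hlk hl0 hlt hN0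
    rw [div_lt_div_iff_of_pos_right hN0] at hlt
    rw [timeCost_eq _ _ _ hl0 hlk hik.1 hik.2, if_pos (by exact_mod_cast hlt), add_zero]
  · have hli : ∀ᶠ k in atTop, l k < i k := by
      filter_upwards [ht.eventually_lt hx h, hNpos] with k hlt hN0
      rw [div_lt_div_iff_of_pos_right hN0] at hlt
      exact_mod_cast hlt
    have h1 := tendsto_scaledMean (p := fun k => N k - l k) hN
      (Eventually.of_forall fun k => Nat.sub_le _ _)
      (tendsto_cast_sub_div hl (tendsto_self_div hN) ht)
    have h2 := tendsto_scaledMean (p := fun k => i k - 1 - l k) hN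
      (hi.mono fun k hk => by omega)
      (tendsto_cast_sub_div (hli.mono fun k hk => by omega)
        (tendsto_cast_sub_div (hi.mono fun k hk => Nat.one_le_iff_ne_zero.2 hk.1) hx
          (tendsto_one_div_nat hN)) ht)
    have hq := tendsto_cast_sub_div (hi.mono fun k hk => hk.2) (tendsto_self_div hN) hx
    have h3 := tendsto_scaledMean (p := fun k => N k - i k) hN
      (Eventually.of_forall fun k => Nat.sub_le _ _) hq
    have h4 := tendsto_negligible_div logCorrection_negligible (p := N) hN
      (Eventually.of_forall fun _ => le_rfl)
    have h5 := tendsto_negligible_div restRem_negligible (p := fun k => N k - l k) hN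
      (Eventually.of_forall fun k => Nat.sub_le _ _)
    have h6 := tendsto_negligible_div restRem_negligible (p := fun k => i k - 1 - l k) hN
      (hi.mono fun k hk => by omega)
    have h7 : Tendsto (fun k => ((N k - i k : ℕ) + 1 : ℝ) / N k) atTop (𝓝 (1 - x + 0)) :=
      (hq.add (tendsto_one_div_nat hN)).congr fun k => by rw [add_div, Nat.cast_one]
    have hall := hr.add (((((((h1.sub h2).sub h3).add h4).add h5).sub h6)).sub (h7.const_mul 2))
    have hlim : limitRankCost x + (2 * ((1 - t) * Real.log (1 - t)) -
        2 * ((x - 0 - t) * Real.log (x - 0 - t)) - 2 * ((1 - x) * Real.log (1 - x)) + 0 + 0 - 0 -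
        2 * (1 - x + 0)) = limitTimeCost t x := by
      simp only [limitTimeCost, if_pos h, sub_zero]
      ring
    rw [hlim] at hall
    refine hall.congr' ?_
    filter_upwards [hi, hli, hlpos] with k hik hlk hl0
    rw [timeCost_eq_scaled _ _ _ hl0 hlk hik.2]

theorem exists_limitRankCost_le : ∃ K, ∀ x ∈ Set.Icc (0 : ℝ) 1, |limitRankCost x| ≤ K := by
  have hc : Continuous limitRankCost := by
    have h1 := Real.continuous_mul_log
    have h2 : Continuous fun x : ℝ => (1 - x) * Real.log (1 - x) :=
      h1.comp (continuous_const.sub continuous_id)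
    have : limitRankCost = fun x => 1 + 2 * (x * Real.log x) + 2 * ((1 - x) * Real.log (1 - x)) := by
      funext x
      rw [limitRankCost]
      ring
    rw [this]
    fun_prop
  exact isCompact_Icc.exists_bound_of_continuousOn hc.continuousOn

theorem exists_limitTimeCost_le : ∃ K, ∀ t ∈ Set.Icc (0 : ℝ) 1, ∀ x ∈ Set.Icc (0 : ℝ) 1,
    |limitTimeCost t x| ≤ K := by
  obtain ⟨K, hK⟩ := exists_limitRankCost_le
  obtain ⟨L, hL⟩ := (isCompact_Icc (a := (0 : ℝ)) (b := 1)).exists_bound_of_continuousOn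
    Real.continuous_mul_log.continuousOn
  have hL0 : 0 ≤ L := (norm_nonneg _).trans (hL 0 (by simp))
  refine ⟨K + 2 * (1 + L + L + L), fun t ht x hx => ?_⟩
  have hr := hK x hx
  rw [limitTimeCost]
  split_ifs with h
  · have h1 := hL (1 - t) ⟨by linarith [ht.2], by linarith [ht.1]⟩
    have h2 := hL (1 - x) ⟨by linarith [hx.2], by linarith [hx.1]⟩
    have h3 := hL (x - t) ⟨by linarith, by linarith [ht.1, hx.2]⟩
    have := hx.1
    have := hx.2
    rw [Real.norm_eq_abs] at h1 h2 h3
    rw [abs_le] at *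
    constructor <;> linarith [h1.1, h1.2, h2.1, h2.2, h3.1, h3.2, hr.1, hr.2]
  · rw [mul_zero, add_zero]
    linarith

/-! ### The pivot rank -/

section pivotRank

theorem pivotRank_eq (u : Vertex → ℝ) (v : Vertex) (n : ℕ) :
    pivotRank u v n = ⌈(n : ℝ) * u v⌉₊ := rfl

theorem pivotRank_ne_zero {u : Vertex → ℝ} {v : Vertex} (hu : u v ∈ Set.Ioo (0 : ℝ) 1) {n : ℕ}
    (hn : n ≠ 0) : pivotRank u v n ≠ 0 := by
  have : 0 < (n : ℝ) * u v := mul_pos (by positivity) hu.1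
  exact (Nat.ceil_pos.2 this).ne'

theorem pivotRank_le {u : Vertex → ℝ} {v : Vertex} (hu : u v ∈ Set.Ioo (0 : ℝ) 1) (n : ℕ) :
    pivotRank u v n ≤ n := by
  rw [pivotRank_eq, Nat.ceil_le]
  nlinarith [hu.2, (Nat.cast_nonneg n : (0 : ℝ) ≤ n)]

theorem le_pivotRank (u : Vertex → ℝ) (v : Vertex) (n : ℕ) : (n : ℝ) * u v ≤ pivotRank u v n :=
  Nat.le_ceil _

theorem pivotRank_lt {u : Vertex → ℝ} {v : Vertex} (hu : u v ∈ Set.Ioo (0 : ℝ) 1) (n : ℕ) :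
    (pivotRank u v n : ℝ) < n * u v + 1 :=
  Nat.ceil_lt_add_one (mul_nonneg (Nat.cast_nonneg n) hu.1.le)

theorem tendsto_pivotRank_div {u : Vertex → ℝ} {v : Vertex} (hu : u v ∈ Set.Ioo (0 : ℝ) 1)
    {N : ℕ → ℕ} (hN : Tendsto N atTop atTop) :
    Tendsto (fun k => (pivotRank u v (N k) / N k : ℝ)) atTop (𝓝 (u v)) := by
  have := (tendsto_nat_ceil_mul_div_atTop hu.1.le).comp (tendsto_natCast_atTop_atTop.comp hN)
  refine this.congr fun k => ?_
  simp [pivotRank_eq, mul_comm]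

theorem eventually_pivotRank {u : Vertex → ℝ} {v : Vertex} (hu : u v ∈ Set.Ioo (0 : ℝ) 1)
    {N : ℕ → ℕ} (hN : Tendsto N atTop atTop) :
    ∀ᶠ k in atTop, pivotRank u v (N k) ≠ 0 ∧ pivotRank u v (N k) ≤ N k :=
  (hN.eventually_ne_atTop 0).mono fun _ hk => ⟨pivotRank_ne_zero hu hk, pivotRank_le hu _⟩

theorem tendsto_left_div {u : Vertex → ℝ} {v : Vertex} (hu : u v ∈ Set.Ioo (0 : ℝ) 1)
    {N : ℕ → ℕ} (hN : Tendsto N atTop atTop) :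
    Tendsto (fun k => ((pivotRank u v (N k) - 1 : ℕ) / N k : ℝ)) atTop (𝓝 (u v)) := by
  have := tendsto_cast_sub_div ((eventually_pivotRank hu hN).mono fun k hk =>
    Nat.one_le_iff_ne_zero.2 hk.1) (tendsto_pivotRank_div hu hN) (tendsto_one_div_nat hN)
  rwa [sub_zero] at this

theorem tendsto_right_div {u : Vertex → ℝ} {v : Vertex} (hu : u v ∈ Set.Ioo (0 : ℝ) 1)
    {N : ℕ → ℕ} (hN : Tendsto N atTop atTop) :
    Tendsto (fun k => ((N k - pivotRank u v (N k) : ℕ) / N k : ℝ)) atTop (𝓝 (1 - u v)) :=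
  tendsto_cast_sub_div ((eventually_pivotRank hu hN).mono fun _ hk => hk.2) (tendsto_self_div hN)
    (tendsto_pivotRank_div hu hN)

theorem tendsto_atTop_of_div {p N : ℕ → ℕ} {y : ℝ} (hy : 0 < y) (hN : Tendsto N atTop atTop)
    (h : Tendsto (fun k => (p k / N k : ℝ)) atTop (𝓝 y)) : Tendsto p atTop atTop := by
  rw [← tendsto_natCast_atTop_iff (R := ℝ)]
  have hNr : Tendsto (fun k => (N k : ℝ)) atTop atTop := tendsto_natCast_atTop_atTop.comp hN
  refine (hNr.atTop_mul_pos hy h).congr' ?_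
  filter_upwards [hN.eventually_ne_atTop 0] with k hk
  have : (N k : ℝ) ≠ 0 := by exact_mod_cast hk
  field_simp

theorem tendsto_left {u : Vertex → ℝ} {v : Vertex} (hu : u v ∈ Set.Ioo (0 : ℝ) 1)
    {N : ℕ → ℕ} (hN : Tendsto N atTop atTop) :
    Tendsto (fun k => pivotRank u v (N k) - 1) atTop atTop :=
  tendsto_atTop_of_div hu.1 hN (tendsto_left_div hu hN)

theorem tendsto_right {u : Vertex → ℝ} {v : Vertex} (hu : u v ∈ Set.Ioo (0 : ℝ) 1)
    {N : ℕ → ℕ} (hN : Tendsto N atTop atTop) :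
    Tendsto (fun k => N k - pivotRank u v (N k)) atTop atTop :=
  tendsto_atTop_of_div (sub_pos.2 hu.2) hN (tendsto_right_div hu hN)

/-- Rounding up and removing the pivot can only shrink the left share. Together with `right_div_le`,
the finite factors are dominated by the limiting ones, so `2 / 3` serves as contraction constant for
every `n`. -/
theorem left_div_le {u : Vertex → ℝ} {v : Vertex} (hu : u v ∈ Set.Ioo (0 : ℝ) 1) {n : ℕ}
    (hn : n ≠ 0) : ((pivotRank u v n : ℝ) - 1) / n ≤ u v := by
  have hn' : (0 : ℝ) < n := by positivity
  rw [div_le_iff₀ hn']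
  linarith [pivotRank_lt hu n]

theorem right_div_le {u : Vertex → ℝ} {v : Vertex} {n : ℕ} (hn : n ≠ 0) :
    1 - (pivotRank u v n : ℝ) / n ≤ 1 - u v := by
  have hn' : (0 : ℝ) < n := by positivity
  have := le_pivotRank u v n
  have : u v ≤ (pivotRank u v n : ℝ) / n := by
    rw [le_div_iff₀ hn']
    linarith
  linarith

theorem one_le_pivotRank {u : Vertex → ℝ} {v : Vertex} (hu : u v ∈ Set.Ioo (0 : ℝ) 1) {n : ℕ}
    (hn : n ≠ 0) : (1 : ℝ) ≤ pivotRank u v n := by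
  exact_mod_cast Nat.one_le_iff_ne_zero.2 (pivotRank_ne_zero hu hn)

theorem left_div_nonneg {u : Vertex → ℝ} {v : Vertex} (hu : u v ∈ Set.Ioo (0 : ℝ) 1) {n : ℕ}
    (hn : n ≠ 0) : 0 ≤ ((pivotRank u v n : ℝ) - 1) / n :=
  div_nonneg (by linarith [one_le_pivotRank hu hn]) (Nat.cast_nonneg n)

theorem pivotSplit_le_one {u : Vertex → ℝ} {v : Vertex} (hu : u v ∈ Set.Ioo (0 : ℝ) 1) {n : ℕ}
    (hn : n ≠ 0) : (pivotRank u v n : ℝ) / n ≤ 1 := by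
  rw [div_le_one (by positivity)]
  exact_mod_cast pivotRank_le hu n

end pivotRank

/-! ### Functions of the root label -/

theorem ae_treeLaw_root {p : ℝ → Prop} (h : ∀ᵐ x ∂unif, p x) : ∀ᵐ u ∂treeLaw, p (u []) := by
  rw [← map_root] at h
  exact ae_of_ae_map (measurable_pi_apply _).aemeasurable h

theorem eLpNorm_le_of_root_bound {c : ℝ → ℝ} {K : ℝ} (hK : ∀ x ∈ Set.Ioo (0 : ℝ) 1, |c x| ≤ K) :
    eLpNorm (fun u : Vertex → ℝ => c (u [])) 2 treeLaw ≤ ENNReal.ofReal K := by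
  refine (eLpNorm_le_of_ae_bound (C := K) ?_).trans_eq (by simp)
  exact ae_treeLaw_root (ae_unif_mem_Ioo.mono hK)

theorem tendsto_eLpNorm_root {c : ℕ → ℝ → ℝ} (hc : ∀ n, Measurable (c n)) {K : ℝ}
    (hK : ∀ n, ∀ x ∈ Set.Ioo (0 : ℝ) 1, |c n x| ≤ K)
    (h : ∀ᵐ x ∂unif, Tendsto (fun n => c n x) atTop (𝓝 0)) :
    Tendsto (fun n => eLpNorm (fun u : Vertex → ℝ => c n (u [])) 2 treeLaw) atTop (𝓝 0) := by
  have hconst : ∀ y : ℝ, eLpNorm (fun _ : (Vertex → ℝ) × (Vertex → ℝ) => y) 2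
      (treeLaw.prod treeLaw) = ‖y‖ₑ := fun y => by
    rw [eLpNorm_const y two_ne_zero (IsProbabilityMeasure.ne_zero _)]
    simp
  refine tendsto_eLpNorm_of_node (M := ENNReal.ofReal K)
    (fun n => (hc n).comp (measurable_pi_apply _)) ENNReal.ofReal_ne_top (fun n => ?_) ?_
  · refine ae_unif_mem_Ioo.mono fun x hx => ?_
    simp only [node_nil, hconst]
    rw [← ofReal_norm]
    exact ENNReal.ofReal_le_ofReal (hK n x hx)
  · refine h.mono fun x hx => ?_
    simp only [node_nil, hconst]
    simpa using hx.enorm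

theorem integral_root (c : ℝ → ℝ) (hc : Measurable c) :
    ∫ u, c (u []) ∂treeLaw = ∫ x, c x ∂unif := by
  rw [← map_root, integral_map (measurable_pi_apply _).aemeasurable hc.aestronglyMeasurable]

/-- The rank `⌈n x⌉` equals `i + 1` on the interval from `i / n` to `(i + 1) / n`, open on the left
and closed on the right. -/
theorem integral_unif_pivot (n : ℕ) (hn : n ≠ 0) (c : ℕ → ℝ) :
    ∫ x, c ⌈(n : ℝ) * x⌉₊ ∂unif = (n : ℝ)⁻¹ * ∑ i ∈ Finset.range n, c (i + 1) := by
  have hn' : (0 : ℝ) < n := by positivity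
  have hpiece : ∀ i : ℕ, Set.EqOn (fun x : ℝ => c ⌈(n : ℝ) * x⌉₊) (fun _ => c (i + 1))
      (Set.Ioc (i / n : ℝ) ((i + 1 : ℕ) / n : ℝ)) := by
    intro i x hx
    have h1 : (i : ℝ) < n * x := by
      have := hx.1
      rw [div_lt_iff₀ hn'] at this
      linarith
    have h2 : (n : ℝ) * x ≤ (i + 1 : ℕ) := by
      have := hx.2
      rw [le_div_iff₀ hn'] at this
      linarith
    have : ⌈(n : ℝ) * x⌉₊ = i + 1 := by
      rw [Nat.ceil_eq_iff (Nat.succ_ne_zero i)]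
      exact ⟨by simpa using h1, h2⟩
    simp only [this]
  have hle : ∀ i : ℕ, (i / n : ℝ) ≤ ((i + 1 : ℕ) / n : ℝ) := fun i => by
    gcongr
    simp
  have hint : ∀ i < n, IntervalIntegrable (fun x : ℝ => c ⌈(n : ℝ) * x⌉₊) volume
      (i / n : ℝ) ((i + 1 : ℕ) / n : ℝ) := by
    intro i _
    rw [intervalIntegrable_iff_integrableOn_Ioc_of_le (hle i)]
    exact (integrableOn_congr_fun (hpiece i) measurableSet_Ioc).2 (by simp)
  have hsum := intervalIntegral.sum_integral_adjacent_intervals (a := fun i : ℕ => (i / n : ℝ)) hint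
  rw [unif, integral_Icc_eq_integral_Ioc, ← intervalIntegral.integral_of_le zero_le_one]
  simp only [Nat.cast_zero, zero_div, div_self hn'.ne'] at hsum
  rw [← hsum, Finset.mul_sum]
  refine Finset.sum_congr rfl fun i _ => ?_
  rw [intervalIntegral.integral_of_le (hle i), setIntegral_congr_fun measurableSet_Ioc (hpiece i)]
  simp only [integral_const, smul_eq_mul, measureReal_restrict_apply_univ, Real.volume_real_Ioc]
  rw [max_eq_left (by linarith [hle i])]
  push_cast
  field_simp
  ring

/-! ### The total cost -/

theorem measurable_pivotRank (n : ℕ) :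
    Measurable fun x : ℝ => pivotRank (fun _ => x) [] n :=
  Nat.measurable_ceil.comp (measurable_const.mul measurable_id)

theorem measurable_sizeFactor (i : Fin 2) (n : ℕ∞) :
    Measurable fun x : ℝ => sizeFactor (fun _ => x) [] i n := by
  have hcomp : ∀ (n : ℕ) (g : ℕ → ℝ), Measurable fun x : ℝ => g (pivotRank (fun _ => x) [] n) :=
    fun n g => (measurable_from_top (f := g)).comp (measurable_pivotRank n)
  match i, n with
  | 0, ⊤ => exact measurable_id
  | 1, ⊤ => exact measurable_const.sub measurable_id
  | 0, (n : ℕ) => exact hcomp n fun r => ((r - 1 : ℕ) : ℝ) / n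
  | 1, (n : ℕ) => exact hcomp n fun r => ((n - r : ℕ) : ℝ) / n

theorem measurable_sublistSize (i : Fin 2) (n : ℕ∞) :
    Measurable fun x : ℝ => sublistSize (fun _ => x) [] i n := by
  have hcomp : ∀ (n : ℕ) (g : ℕ → ℕ∞), Measurable fun x : ℝ => g (pivotRank (fun _ => x) [] n) :=
    fun n g => (measurable_from_top (f := g)).comp (measurable_pivotRank n)
  match i, n with
  | 0, ⊤ => exact measurable_const
  | 1, ⊤ => exact measurable_const
  | 0, (n : ℕ) => exact hcomp n fun r => ((r - 1 : ℕ) : ℕ∞)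
  | 1, (n : ℕ) => exact hcomp n fun r => ((n - r : ℕ) : ℕ∞)

theorem measurable_limitRankCost : Measurable limitRankCost := by
  unfold limitRankCost
  fun_prop

/-- The vertex cost for the total cost, as a function of the splitting variable. -/
noncomputable def rootCost (n : ℕ∞) (x : ℝ) : ℝ := sizeCost (fun _ => x) [] n

theorem measurable_rootCost (n : ℕ∞) : Measurable (rootCost n) := by
  match n with
  | ⊤ => exact measurable_limitRankCost
  | (n : ℕ) => exact (measurable_from_top (f := rankCost n)).comp (measurable_pivotRank n)

theorem sizeCost_eq (u : Vertex → ℝ) (v : Vertex) (n : ℕ∞) : sizeCost u v n = rootCost n (u v) := by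
  match n with
  | ⊤ => rfl
  | (n : ℕ) => rfl

/-- The weights at `v` see only the label of `v`, so a constant labelling read at the root
represents them as functions of one real variable. -/
theorem sizeFactor_eq (u : Vertex → ℝ) (v : Vertex) (i : Fin 2) (n : ℕ∞) :
    sizeFactor u v i n = sizeFactor (fun _ => u v) [] i n := by
  match i, n with
  | 0, ⊤ => rfl
  | 1, ⊤ => rfl
  | 0, (n : ℕ) => rfl
  | 1, (n : ℕ) => rfl

theorem sublistSize_eq (u : Vertex → ℝ) (v : Vertex) (i : Fin 2) (n : ℕ∞) :
    sublistSize u v i n = sublistSize (fun _ => u v) [] i n := by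
  match i, n with
  | 0, ⊤ => rfl
  | 1, ⊤ => rfl
  | 0, (n : ℕ) => rfl
  | 1, (n : ℕ) => rfl

/-- The scheme of the total cost. -/
noncomputable def sizeScheme : Scheme ℕ∞ where
  factor i n x := sizeFactor (fun _ => x) [] i n
  move i n x := sublistSize (fun _ => x) [] i n
  cost n u := rootCost n (u [])
  measurable_factor i := measurable_from_prod_countable_right fun n => measurable_sizeFactor i n
  measurable_move i := measurable_from_prod_countable_right fun n => measurable_sublistSize i n
  measurable_cost := measurable_from_prod_countable_right fun n =>
    (measurable_rootCost n).comp (measurable_pi_apply _)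

theorem weight_sizeScheme (u : Vertex → ℝ) : sizeScheme.weight u = sizeWeight u := by
  funext v i
  apply Weight.ext
  · funext n
    exact (sizeFactor_eq u v i n).symm
  · funext n
    exact (sublistSize_eq u v i n).symm

theorem vertexCost_sizeScheme (u : Vertex → ℝ) : sizeScheme.vertexCost u = sizeCost u := by
  funext v n
  rw [sizeCost_eq]
  simp [Scheme.vertexCost, sizeScheme, subtree]

theorem totalSortCost_eq (u : Vertex → ℝ) (v : Vertex) (n : ℕ∞) :
    totalSortCost u v n = sizeScheme.lim n (subtree v u) := by
  rw [totalSortCost, ← weight_sizeScheme, ← vertexCost_sizeScheme, Scheme.totalCost_eq_lim]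

theorem exists_rootCost_le : ∃ K, ∀ n, ∀ x ∈ Set.Ioo (0 : ℝ) 1, |rootCost n x| ≤ K := by
  obtain ⟨K, hK⟩ := exists_rankCost_le
  obtain ⟨L, hL⟩ := exists_limitRankCost_le
  refine ⟨max K L, fun n x hx => ?_⟩
  match n with
  | ⊤ => exact (hL x ⟨hx.1.le, hx.2.le⟩).trans (le_max_right _ _)
  | (n : ℕ) =>
    rcases eq_or_ne n 0 with rfl | hn
    · simp only [rootCost, sizeCost, rankCost, if_true, abs_zero]
      exact (abs_nonneg _).trans ((hK 1 1 one_ne_zero le_rfl).trans (le_max_left _ _))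
    · exact (hK n _ (pivotRank_ne_zero (u := fun _ => x) (v := []) hx hn)
        (pivotRank_le (u := fun _ => x) (v := []) hx n)).trans (le_max_left _ _)

theorem tendsto_rootCost {N : ℕ → ℕ} (hN : Tendsto N atTop atTop) {x : ℝ}
    (hx : x ∈ Set.Ioo (0 : ℝ) 1) :
    Tendsto (fun k => rootCost (N k) x) atTop (𝓝 (rootCost ⊤ x)) :=
  tendsto_rankCost (i := fun k => pivotRank (fun _ => x) [] (N k)) hN
    (eventually_pivotRank (u := fun _ => x) (v := []) hx hN)
    (tendsto_pivotRank_div (u := fun _ => x) (v := []) hx hN)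

theorem integral_rootCost_nat (n : ℕ) : ∫ x, rootCost n x ∂unif = 0 := by
  rcases eq_or_ne n 0 with rfl | hn
  · simp [rootCost, sizeCost, rankCost]
  · exact (integral_unif_pivot n hn (rankCost n)).trans (by rw [sum_rankCost, mul_zero])

/-- For the limit cost the mean is obtained from finite `n` by dominated convergence, without
integrating logarithms. -/
theorem integral_rootCost (n : ℕ∞) : ∫ x, rootCost n x ∂unif = 0 := by
  match n with
  | (n : ℕ) => exact integral_rootCost_nat n
  | ⊤ =>
    obtain ⟨K, hK⟩ := exists_rootCost_le
    have := tendsto_integral_of_dominated_convergence (μ := unif)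
      (F := fun n : ℕ => rootCost n) (f := rootCost ⊤) (fun _ => K)
      (fun n => (measurable_rootCost n).aestronglyMeasurable) (integrable_const K)
      (fun n => ae_unif_mem_Ioo.mono fun x hx => hK n x hx)
      (ae_unif_mem_Ioo.mono fun x hx => tendsto_rootCost tendsto_id hx)
    simp only [integral_rootCost_nat] at this
    exact (tendsto_nhds_unique this tendsto_const_nhds)

theorem sizeFactor_zero_mem {x : ℝ} (hx : x ∈ Set.Ioo (0 : ℝ) 1) (n : ℕ∞) :
    sizeFactor (fun _ => x) [] 0 n ∈ Set.Icc 0 x := by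
  match n with
  | ⊤ => exact ⟨hx.1.le, le_rfl⟩
  | (n : ℕ) =>
    rcases eq_or_ne n 0 with rfl | hn
    · simp [sizeFactor, hx.1.le]
    · have h := left_div_le (u := fun _ => x) (v := []) hx hn
      refine ⟨div_nonneg (Nat.cast_nonneg _) (Nat.cast_nonneg _), ?_⟩
      change ((pivotRank (fun _ => x) [] n - 1 : ℕ) : ℝ) / n ≤ x
      rw [Nat.cast_sub (Nat.one_le_iff_ne_zero.2 (pivotRank_ne_zero hx hn))]
      exact_mod_cast h

theorem sizeFactor_one_mem {x : ℝ} (hx : x ∈ Set.Ioo (0 : ℝ) 1) (n : ℕ∞) :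
    sizeFactor (fun _ => x) [] 1 n ∈ Set.Icc 0 (1 - x) := by
  match n with
  | ⊤ => exact ⟨sub_nonneg.2 hx.2.le, le_rfl⟩
  | (n : ℕ) =>
    rcases eq_or_ne n 0 with rfl | hn
    · simp [sizeFactor, hx.2.le]
    · have h := right_div_le (u := fun _ => x) (v := []) hn
      refine ⟨div_nonneg (Nat.cast_nonneg _) (Nat.cast_nonneg _), ?_⟩
      have hn' : (n : ℝ) ≠ 0 := by exact_mod_cast hn
      change ((n - pivotRank (fun _ => x) [] n : ℕ) : ℝ) / n ≤ 1 - x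
      rw [Nat.cast_sub (pivotRank_le hx n), sub_div, div_self hn']
      exact h

/-- Both factors can be positive at once here, so orthogonality rests on the centred costs. -/
theorem exists_contractive_sizeScheme : ∃ κ, sizeScheme.Contractive Set.univ κ := by
  obtain ⟨K, hK⟩ := exists_rootCost_le
  have hfactor : ∀ n ∈ Set.univ, ∀ x ∈ Set.Ioo (0 : ℝ) 1,
      sizeScheme.factor 0 n x ^ 2 + sizeScheme.factor 1 n x ^ 2 ≤ x ^ 2 + (1 - x) ^ 2 := by
    intro n _ x hx
    have h0 := sizeFactor_zero_mem hx n
    have h1 := sizeFactor_one_mem hx n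
    exact add_le_add (pow_le_pow_left₀ h0.1 h0.2 2) (pow_le_pow_left₀ h1.1 h1.2 2)
  have hcost : ∀ n ∈ Set.univ, eLpNorm (sizeScheme.cost n) 2 treeLaw ≤ ENNReal.ofReal K :=
    fun n _ => eLpNorm_le_of_root_bound (c := rootCost n) (hK n)
  have hmean : ∀ n ∈ Set.univ, ∫ u, sizeScheme.cost n u ∂treeLaw = 0 := by
    intro n _
    have h1 := integral_root _ (measurable_rootCost n)
    rw [integral_rootCost n] at h1
    exact h1
  exact ⟨ENNReal.ofReal K, fun _ _ _ _ _ => trivial, hfactor, ENNReal.ofReal_ne_top, hcost,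
    Or.inr hmean⟩

/-- Convergence of list lengths to infinity. -/
def SizeConv (σ : ℕ → ℕ∞) (s : ℕ∞) : Prop :=
  s = ⊤ ∧ ∃ N : ℕ → ℕ, Tendsto N atTop atTop ∧ ∀ k, σ k = N k

theorem continuous_sizeScheme : sizeScheme.Continuous Set.univ SizeConv where
  mem _ := ⟨trivial, fun _ => trivial⟩
  factor := by
    rintro σ s ⟨rfl, N, hN, hσ⟩
    refine ae_unif_mem_Ioo.mono fun x hx i => ?_
    simp only [hσ]
    match i with
    | 0 => exact tendsto_left_div (u := fun _ => x) (v := []) hx hN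
    | 1 => exact tendsto_right_div (u := fun _ => x) (v := []) hx hN
  move := by
    rintro σ s ⟨rfl, N, hN, hσ⟩
    refine ae_unif_mem_Ioo.mono fun x hx i => Or.inr ?_
    simp only [hσ]
    match i with
    | 0 => exact ⟨rfl, _, tendsto_left (u := fun _ => x) (v := []) hx hN, fun _ => rfl⟩
    | 1 => exact ⟨rfl, _, tendsto_right (u := fun _ => x) (v := []) hx hN, fun _ => rfl⟩
  cost := by
    rintro σ s ⟨rfl, N, hN, hσ⟩
    simp only [hσ]
    obtain ⟨K, hK⟩ := exists_rootCost_le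
    refine tendsto_eLpNorm_root (c := fun k x => rootCost (N k) x - rootCost ⊤ x) (K := K + K)
      (fun k => (measurable_rootCost _).sub (measurable_rootCost _))
      (fun k x hx => (abs_sub _ _).trans (add_le_add (hK _ x hx) (hK _ x hx)))
      (ae_unif_mem_Ioo.mono fun x hx => ?_)
    simpa using (tendsto_rootCost hN hx).sub_const (rootCost ⊤ x)

theorem tendsto_totalSortCost {N : ℕ → ℕ} (hN : Tendsto N atTop atTop) :
    Tendsto (fun k => eLpNorm (sizeScheme.lim (N k : ℕ∞) - sizeScheme.lim ⊤) 2 treeLaw)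
      atTop (𝓝 0) := by
  obtain ⟨κ, h⟩ := exists_contractive_sizeScheme
  exact h.tendsto_lim continuous_sizeScheme (σ := fun k => (N k : ℕ∞)) ⟨rfl, N, hN, fun _ => rfl⟩

theorem exists_totalSortCost_le : ∃ M : ℝ≥0∞, M ≠ ∞ ∧
    ∀ n, eLpNorm (sizeScheme.lim n) 2 treeLaw ≤ M := by
  obtain ⟨κ, h⟩ := exists_contractive_sizeScheme
  exact ⟨_, Scheme.tail_ne_top h.ne_top 0, fun n => h.eLpNorm_lim_le trivial⟩

/-! ### The Quicksort process -/

/-- The part of the vertex costs that only depends on the splitting variable `x`. -/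
noncomputable def timeTerm (t x : ℝ) : ℕ∞ → ℝ
  | ⊤ => limitTimeCost t x
  | (n : ℕ) => if n = 0 then 0 else timeCost n ⌊(n : ℝ) * t⌋₊ (pivotRank (fun _ => x) [] n)

/-- The weight of the total cost of the left sublist in the vertex costs. -/
noncomputable def splitWeight (t x : ℝ) : ℕ∞ → ℝ
  | ⊤ => if x ≤ t then x else 0
  | (n : ℕ) =>
    if n = 0 then 0
    else if pivotSplit (fun _ => x) [] n ≤ t then ((pivotRank (fun _ => x) [] n : ℝ) - 1) / n
    else 0

theorem processCostAt_eq (u : Vertex → ℝ) (v : Vertex) (t : ℝ) (n : ℕ∞) :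
    processCostAt u v t n = timeTerm t (u v) n + splitWeight t (u v) n *
      sizeScheme.lim (sublistSize (fun _ => u v) [] 0 n) (subtree (v ++ [0]) u) := by
  match n with
  | ⊤ =>
    change limitTimeCost t (u v) + (if u v ≤ t then u v * totalSortCost u (v ++ [0]) ⊤ else 0) =
      limitTimeCost t (u v) + (if u v ≤ t then u v else 0) * sizeScheme.lim ⊤ _
    rw [totalSortCost_eq, ite_mul, zero_mul]
  | (n : ℕ) =>
    by_cases hn : n = 0
    · subst hn
      simp [processCostAt, timeTerm, splitWeight]
    · simp only [processCostAt, totalSortCost_eq, timeTerm, splitWeight, ite_mul, zero_mul, hn,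
        if_false]
      rfl

theorem timeFactor_eq (u : Vertex → ℝ) (v : Vertex) (i : Fin 2) (t : ℝ) (n : ℕ∞) :
    timeFactor u v i t n = timeFactor (fun _ => u v) [] i t n := by
  match i, n with
  | 0, ⊤ => rfl
  | 1, ⊤ => rfl
  | 0, (n : ℕ) => rfl
  | 1, (n : ℕ) => rfl

theorem timeMove_eq (u : Vertex → ℝ) (v : Vertex) (i : Fin 2) (t : ℝ) (n : ℕ∞) :
    timeMove u v i t n = timeMove (fun _ => u v) [] i t n := by
  match i, n with
  | 0, ⊤ => rfl
  | 1, ⊤ => rfl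
  | 0, (n : ℕ) => rfl
  | 1, (n : ℕ) => rfl

section measurability

/-- The index set `ℕ∞` is countable, so measurability may be checked for each fixed index. -/
theorem measurable_of_forall_index {β γ : Type*} [MeasurableSpace β] [MeasurableSpace γ]
    {F : (ℝ × ℕ∞) × β → γ} (h : ∀ n, Measurable fun p : ℝ × β => F ((p.1, n), p.2)) :
    Measurable F := by
  have hG : Measurable fun q : ℕ∞ × ℝ × β => F ((q.2.1, q.1), q.2.2) :=
    measurable_from_prod_countable_right fun n => h n
  exact hG.comp ((measurable_snd.comp measurable_fst).prodMk
    ((measurable_fst.comp measurable_fst).prodMk measurable_snd))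

theorem measurable_pivotRank_snd (n : ℕ) :
    Measurable fun p : ℝ × ℝ => (pivotRank (fun _ => p.2) [] n : ℝ) :=
  (measurable_from_top (f := fun k : ℕ => (k : ℝ))).comp
    ((measurable_pivotRank n).comp measurable_snd)

theorem measurable_pivotSplit_snd (n : ℕ) :
    Measurable fun p : ℝ × ℝ => pivotSplit (fun _ => p.2) [] n :=
  (measurable_pivotRank_snd n).div_const _

theorem measurable_floor_fst (n : ℕ) : Measurable fun p : ℝ × ℝ => ⌊(n : ℝ) * p.1⌋₊ :=
  Nat.measurable_floor.comp (measurable_const.mul measurable_fst)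

theorem measurable_timeFactor (i : Fin 2) (n : ℕ∞) :
    Measurable fun p : ℝ × ℝ => timeFactor (fun _ => p.2) [] i p.1 n := by
  match i, n with
  | 0, ⊤ =>
    exact Measurable.ite (measurableSet_lt measurable_fst measurable_snd)
      measurable_snd measurable_const
  | 1, ⊤ =>
    exact Measurable.ite (measurableSet_le measurable_snd measurable_fst)
      (measurable_const.sub measurable_snd) measurable_const
  | 0, (n : ℕ) =>
    exact Measurable.ite (MeasurableSet.const _) measurable_const
      (Measurable.ite (measurableSet_lt measurable_fst (measurable_pivotSplit_snd n))
        (((measurable_pivotRank_snd n).sub_const 1).div_const _) measurable_const)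
  | 1, (n : ℕ) =>
    exact Measurable.ite (MeasurableSet.const _) measurable_const
      (Measurable.ite (measurableSet_le (measurable_pivotSplit_snd n) measurable_fst)
        (measurable_const.sub ((measurable_pivotRank_snd n).div_const _)) measurable_const)

theorem measurable_timeMove (i : Fin 2) (n : ℕ∞) :
    Measurable fun p : ℝ × ℝ => timeMove (fun _ => p.2) [] i p.1 n := by
  match i, n with
  | 0, ⊤ => exact measurable_const.min (measurable_fst.div measurable_snd)
  | 1, ⊤ =>
    exact measurable_const.max
      ((measurable_fst.sub measurable_snd).div (measurable_const.sub measurable_snd))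
  | 0, (n : ℕ) =>
    exact measurable_const.min (((measurable_from_top (f := fun k : ℕ => (k : ℝ))).comp
      (measurable_floor_fst n)).div ((measurable_pivotRank_snd n).sub_const 1))
  | 1, (n : ℕ) =>
    exact measurable_const.max ((measurable_fst.sub (measurable_pivotSplit_snd n)).div
      (measurable_const.sub (measurable_pivotSplit_snd n)))

theorem measurable_limitTimeCost : Measurable fun p : ℝ × ℝ => limitTimeCost p.1 p.2 := by
  unfold limitTimeCost
  refine (measurable_limitRankCost.comp measurable_snd).add (measurable_const.mul
    (Measurable.ite (measurableSet_lt measurable_fst measurable_snd) ?_ measurable_const))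
  fun_prop

theorem measurable_timeTerm (n : ℕ∞) : Measurable fun p : ℝ × ℝ => timeTerm p.1 p.2 n := by
  match n with
  | ⊤ => exact measurable_limitTimeCost
  | (n : ℕ) =>
    exact Measurable.ite (MeasurableSet.const _) measurable_const
      ((Measurable.of_discrete (f := fun q : ℕ × ℕ => timeCost n q.1 q.2)).comp
        ((measurable_floor_fst n).prodMk ((measurable_pivotRank n).comp measurable_snd)))

theorem measurable_splitWeight (n : ℕ∞) : Measurable fun p : ℝ × ℝ => splitWeight p.1 p.2 n := by
  match n with
  | ⊤ =>
    exact Measurable.ite (measurableSet_le measurable_snd measurable_fst)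
      measurable_snd measurable_const
  | (n : ℕ) =>
    exact Measurable.ite (MeasurableSet.const _) measurable_const
      (Measurable.ite (measurableSet_le (measurable_pivotSplit_snd n) measurable_fst)
        (((measurable_pivotRank_snd n).sub_const 1).div_const _) measurable_const)

end measurability

/-- The contribution of the total cost of the left sublist to the vertex costs at the root. -/
noncomputable def leftCost (s : ℝ × ℕ∞) (u : Vertex → ℝ) : ℝ :=
  splitWeight s.1 (u []) s.2 *
    sizeScheme.lim (sublistSize (fun _ => u []) [] 0 s.2) (subtree [0] u)

theorem measurable_leftCost : Measurable fun p : (ℝ × ℕ∞) × (Vertex → ℝ) => leftCost p.1 p.2 := by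
  refine measurable_of_forall_index fun n => ?_
  have hroot : Measurable fun p : ℝ × (Vertex → ℝ) => (p.1, p.2 []) :=
    measurable_fst.prodMk ((measurable_pi_apply _).comp measurable_snd)
  have hw := (measurable_splitWeight n).comp hroot
  have hj : Measurable fun p : ℝ × (Vertex → ℝ) => sublistSize (fun _ => p.2 []) [] 0 n :=
    (measurable_sublistSize 0 n).comp (measurable_snd.comp hroot)
  have hs : Measurable fun p : ℝ × (Vertex → ℝ) => subtree [0] p.2 :=
    (measurable_subtree [0]).comp measurable_snd
  have hQ := sizeScheme.measurable_lim.comp (hj.prodMk hs)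
  exact hw.mul hQ

theorem measurable_rootTimeTerm :
    Measurable fun p : (ℝ × ℕ∞) × (Vertex → ℝ) => timeTerm p.1.1 (p.2 []) p.1.2 := by
  refine measurable_of_forall_index fun n => ?_
  exact (measurable_timeTerm n).comp
    (measurable_fst.prodMk ((measurable_pi_apply _).comp measurable_snd))

/-- The scheme of the Quicksort process. -/
noncomputable def processScheme : Scheme (ℝ × ℕ∞) where
  factor i s x := timeFactor (fun _ => x) [] i s.1 s.2
  move i s x := (timeMove (fun _ => x) [] i s.1 s.2, sublistSize (fun _ => x) [] i s.2)
  cost s u := timeTerm s.1 (u []) s.2 + leftCost s u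
  measurable_factor i := measurable_of_forall_index fun n => measurable_timeFactor i n
  measurable_move i := measurable_of_forall_index fun n =>
    (measurable_timeMove i n).prodMk ((measurable_sublistSize i n).comp measurable_snd)
  measurable_cost := measurable_rootTimeTerm.add measurable_leftCost

theorem weight_processScheme (u : Vertex → ℝ) : processScheme.weight u = processWeight u := by
  funext v i
  apply Weight.ext
  · funext s
    exact (timeFactor_eq u v i s.1 s.2).symm
  · funext s
    exact Prod.ext (timeMove_eq u v i s.1 s.2).symm (sublistSize_eq u v i s.2).symm

theorem vertexCost_processScheme (u : Vertex → ℝ) :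
    processScheme.vertexCost u = processCost u := by
  funext v s
  rw [processCost, processCostAt_eq, Scheme.subtree_append]
  simp [Scheme.vertexCost, processScheme, leftCost, subtree]

theorem process_eq (u : Vertex → ℝ) (v : Vertex) (t : ℝ) (n : ℕ∞) :
    process u v t n = processScheme.lim (t, n) (subtree v u) := by
  rw [process, ← weight_processScheme, ← vertexCost_processScheme, Scheme.totalCost_eq_lim]

theorem processPartial_eq (u : Vertex → ℝ) (m : ℕ) (v : Vertex) (t : ℝ) (n : ℕ∞) :
    processPartial u m v t n = processScheme.psum m (t, n) (subtree v u) := by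
  rw [processPartial, ← weight_processScheme, ← vertexCost_processScheme,
    Scheme.partialCost_eq_psum]

/-- The pairs of a time in `[0,1]` and a length. -/
def timeDomain : Set (ℝ × ℕ∞) := {s | s.1 ∈ Set.Icc (0 : ℝ) 1}

theorem timeMove_mem {x : ℝ} (hx : x ∈ Set.Ioo (0 : ℝ) 1) (i : Fin 2) {t : ℝ}
    (ht : t ∈ Set.Icc (0 : ℝ) 1) (n : ℕ∞) :
    timeMove (fun _ => x) [] i t n ∈ Set.Icc (0 : ℝ) 1 := by
  match i, n with
  | 0, ⊤ => exact ⟨le_min zero_le_one (div_nonneg ht.1 hx.1.le), min_le_left _ _⟩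
  | 1, ⊤ =>
    refine ⟨le_max_left _ _, max_le zero_le_one ?_⟩
    have h1 : 0 < 1 - x := sub_pos.2 hx.2
    change (t - x) / (1 - x) ≤ 1
    rw [div_le_one h1]
    linarith [ht.2]
  | 0, (n : ℕ) =>
    refine ⟨le_min zero_le_one ?_, min_le_left _ _⟩
    rcases eq_or_ne n 0 with rfl | hn
    · simp
    · exact div_nonneg (Nat.cast_nonneg _)
        (sub_nonneg.2 (one_le_pivotRank (u := fun _ => x) (v := []) hx hn))
  | 1, (n : ℕ) =>
    refine ⟨le_max_left _ _, max_le zero_le_one ?_⟩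
    rcases eq_or_ne n 0 with rfl | hn
    · simpa [pivotSplit] using ht.2
    · have h1 : pivotSplit (fun _ => x) [] n ≤ 1 :=
        pivotSplit_le_one (u := fun _ => x) (v := []) hx hn
      refine div_le_one_of_le₀ ?_ (sub_nonneg.2 h1)
      linarith [ht.2]

theorem timeFactor_zero_mem {x : ℝ} (hx : x ∈ Set.Ioo (0 : ℝ) 1) (t : ℝ) (n : ℕ∞) :
    timeFactor (fun _ => x) [] 0 t n ∈ Set.Icc 0 x := by
  have h0 : (0 : ℝ) ∈ Set.Icc 0 x := ⟨le_rfl, hx.1.le⟩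
  match n with
  | ⊤ =>
    change (if t < x then x else 0) ∈ Set.Icc 0 x
    split_ifs
    · exact ⟨hx.1.le, le_rfl⟩
    · exact h0
  | (n : ℕ) =>
    change (if n = 0 then 0 else if t < pivotSplit (fun _ => x) [] n then
      ((pivotRank (fun _ => x) [] n : ℝ) - 1) / n else 0) ∈ Set.Icc 0 x
    split_ifs with hn
    · exact h0
    · exact ⟨left_div_nonneg (u := fun _ => x) (v := []) hx hn,
        left_div_le (u := fun _ => x) (v := []) hx hn⟩
    · exact h0

theorem timeFactor_one_mem {x : ℝ} (hx : x ∈ Set.Ioo (0 : ℝ) 1) (t : ℝ) (n : ℕ∞) :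
    timeFactor (fun _ => x) [] 1 t n ∈ Set.Icc 0 (1 - x) := by
  have h0 : (0 : ℝ) ∈ Set.Icc 0 (1 - x) := ⟨le_rfl, sub_nonneg.2 hx.2.le⟩
  match n with
  | ⊤ =>
    change (if x ≤ t then 1 - x else 0) ∈ Set.Icc 0 (1 - x)
    split_ifs
    · exact ⟨sub_nonneg.2 hx.2.le, le_rfl⟩
    · exact h0
  | (n : ℕ) =>
    change (if n = 0 then 0 else if pivotSplit (fun _ => x) [] n ≤ t then
      1 - (pivotRank (fun _ => x) [] n : ℝ) / n else 0) ∈ Set.Icc 0 (1 - x)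
    split_ifs with hn
    · exact h0
    · exact ⟨sub_nonneg.2 (pivotSplit_le_one (u := fun _ => x) (v := []) hx hn),
        right_div_le (u := fun _ => x) (v := []) hn⟩
    · exact h0

theorem timeFactor_mul_eq_zero (x t : ℝ) (n : ℕ∞) :
    timeFactor (fun _ => x) [] 0 t n * timeFactor (fun _ => x) [] 1 t n = 0 := by
  match n with
  | ⊤ =>
    change (if t < x then x else 0) * (if x ≤ t then 1 - x else 0) = 0
    rcases lt_or_ge t x with h | h
    · rw [if_neg h.not_ge, mul_zero]
    · rw [if_neg h.not_gt, zero_mul]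
  | (n : ℕ) =>
    change (if n = 0 then 0 else if t < pivotSplit (fun _ => x) [] n then
      ((pivotRank (fun _ => x) [] n : ℝ) - 1) / n else 0) * (if n = 0 then 0 else
      if pivotSplit (fun _ => x) [] n ≤ t then 1 - (pivotRank (fun _ => x) [] n : ℝ) / n else 0) = 0
    rcases lt_or_ge t (pivotSplit (fun _ => x) [] n) with h | h
    · simp [h.not_ge]
    · simp [h.not_gt]

theorem splitWeight_mem {x : ℝ} (hx : x ∈ Set.Ioo (0 : ℝ) 1) (t : ℝ) (n : ℕ∞) :
    splitWeight t x n ∈ Set.Icc (0 : ℝ) 1 := by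
  have h0 : (0 : ℝ) ∈ Set.Icc (0 : ℝ) 1 := ⟨le_rfl, zero_le_one⟩
  match n with
  | ⊤ =>
    change (if x ≤ t then x else 0) ∈ Set.Icc (0 : ℝ) 1
    split_ifs
    · exact ⟨hx.1.le, hx.2.le⟩
    · exact h0
  | (n : ℕ) =>
    unfold splitWeight
    dsimp only
    split_ifs with hn
    · exact h0
    · exact ⟨left_div_nonneg (u := fun _ => x) (v := []) hx hn,
        (left_div_le (u := fun _ => x) (v := []) hx hn).trans hx.2.le⟩
    · exact h0

theorem floor_mul_le {t : ℝ} (ht : t ∈ Set.Icc (0 : ℝ) 1) (n : ℕ) : ⌊(n : ℝ) * t⌋₊ ≤ n :=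
  Nat.floor_le_of_le (by nlinarith [ht.2, (Nat.cast_nonneg n : (0 : ℝ) ≤ n)])

theorem exists_timeTerm_le : ∃ K, ∀ t ∈ Set.Icc (0 : ℝ) 1, ∀ n, ∀ x ∈ Set.Ioo (0 : ℝ) 1,
    |timeTerm t x n| ≤ K := by
  obtain ⟨K, hK⟩ := exists_timeCost_le
  obtain ⟨L, hL⟩ := exists_limitTimeCost_le
  refine ⟨max K L, fun t ht n x hx => ?_⟩
  match n with
  | ⊤ => exact (hL t ht x ⟨hx.1.le, hx.2.le⟩).trans (le_max_right _ _)
  | (n : ℕ) =>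
    unfold timeTerm
    dsimp only
    split_ifs with hn
    · rw [abs_zero]
      exact (abs_nonneg _).trans ((hK 1 1 1 le_rfl one_ne_zero le_rfl).trans (le_max_left _ _))
    · exact (hK n _ _ (floor_mul_le ht n) (pivotRank_ne_zero (u := fun _ => x) (v := []) hx hn)
        (pivotRank_le (u := fun _ => x) (v := []) hx n)).trans (le_max_left _ _)

theorem leftCost_node (s : ℝ × ℕ∞) (x : ℝ) (a b : Vertex → ℝ) : leftCost s (node x a b) =
    splitWeight s.1 x s.2 * sizeScheme.lim (sublistSize (fun _ => x) [] 0 s.2) a := rfl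

theorem measurable_leftCost_right (s : ℝ × ℕ∞) : Measurable (leftCost s) := by
  have h : Measurable (Prod.mk s : (Vertex → ℝ) → (ℝ × ℕ∞) × (Vertex → ℝ)) :=
    measurable_prodMk_left
  have h' := measurable_leftCost.comp h
  exact h'

theorem measurable_timeTerm_right (s : ℝ × ℕ∞) : Measurable fun x => timeTerm s.1 x s.2 := by
  have h : Measurable (Prod.mk s.1 : ℝ → ℝ × ℝ) := measurable_prodMk_left
  have h' := (measurable_timeTerm s.2).comp h
  exact h'

/-- Given the root label, the length of the left sublist is deterministic, and the uniform bound on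
the `L²` norms of the total costs applies. -/
theorem eLpNorm_leftCost_node_le {M : ℝ≥0∞} (hM : ∀ n, eLpNorm (sizeScheme.lim n) 2 treeLaw ≤ M)
    (s : ℝ × ℕ∞) {x : ℝ} (hx : x ∈ Set.Ioo (0 : ℝ) 1) :
    eLpNorm (fun p : (Vertex → ℝ) × (Vertex → ℝ) => leftCost s (node x p.1 p.2)) 2
      (treeLaw.prod treeLaw) ≤ M := by
  have hw := splitWeight_mem hx s.1 s.2
  simp only [leftCost_node]
  set w := splitWeight s.1 x s.2
  set j := sublistSize (fun _ => x) [] 0 s.2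
  have h1 : eLpNorm (fun p : (Vertex → ℝ) × (Vertex → ℝ) => sizeScheme.lim j p.1) 2
      (treeLaw.prod treeLaw) = eLpNorm (sizeScheme.lim j) 2 treeLaw :=
    eLpNorm_comp_measurePreserving (sizeScheme.measurable_lim_right j).aestronglyMeasurable
      measurePreserving_fst
  calc eLpNorm (w • fun p : (Vertex → ℝ) × (Vertex → ℝ) => sizeScheme.lim j p.1) 2
        (treeLaw.prod treeLaw)
      = ‖w‖ₑ * eLpNorm (sizeScheme.lim j) 2 treeLaw := by rw [eLpNorm_const_smul, h1]
    _ ≤ 1 * M := by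
        gcongr
        · rw [← enorm_one (G := ℝ), enorm_le_iff_norm_le]
          simpa [abs_of_nonneg hw.1] using hw.2
        · exact hM j
    _ = M := one_mul M

/-- At any time only one of the two sublists is active, so the product of the factors is zero and no
centring of the costs has to be checked. -/
theorem exists_contractive_processScheme : ∃ κ, processScheme.Contractive timeDomain κ := by
  obtain ⟨K, hK⟩ := exists_timeTerm_le
  obtain ⟨M, hMtop, hM⟩ := exists_totalSortCost_le
  have hmove : ∀ s ∈ timeDomain, ∀ x ∈ Set.Ioo (0 : ℝ) 1, ∀ i,
      processScheme.move i s x ∈ timeDomain := fun s hs x hx i => timeMove_mem hx i hs s.2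
  have hfactor : ∀ s ∈ timeDomain, ∀ x ∈ Set.Ioo (0 : ℝ) 1,
      processScheme.factor 0 s x ^ 2 + processScheme.factor 1 s x ^ 2 ≤ x ^ 2 + (1 - x) ^ 2 := by
    intro s _ x hx
    have h0 := timeFactor_zero_mem hx s.1 s.2
    have h1 := timeFactor_one_mem hx s.1 s.2
    exact add_le_add (pow_le_pow_left₀ h0.1 h0.2 2) (pow_le_pow_left₀ h1.1 h1.2 2)
  have hcost : ∀ s ∈ timeDomain,
      eLpNorm (processScheme.cost s) 2 treeLaw ≤ ENNReal.ofReal K + M := by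
    intro s hs
    have h1 : Measurable fun u : Vertex → ℝ => timeTerm s.1 (u []) s.2 :=
      (measurable_timeTerm_right s).comp (measurable_pi_apply _)
    have h2 := measurable_leftCost_right s
    change eLpNorm ((fun u : Vertex → ℝ => timeTerm s.1 (u []) s.2) + leftCost s) 2 treeLaw ≤ _
    refine (eLpNorm_add_le h1.aestronglyMeasurable h2.aestronglyMeasurable one_le_two).trans
      (add_le_add ?_ ?_)
    · exact eLpNorm_le_of_root_bound (c := fun x => timeTerm s.1 x s.2) (hK s.1 hs s.2)
    · exact eLpNorm_le_of_node h2
        (ae_unif_mem_Ioo.mono fun x hx => eLpNorm_leftCost_node_le hM s hx)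
  have hcross : ∀ s ∈ timeDomain, ∀ x ∈ Set.Ioo (0 : ℝ) 1,
      processScheme.factor 0 s x * processScheme.factor 1 s x = 0 :=
    fun s _ x _ => timeFactor_mul_eq_zero x s.1 s.2
  exact ⟨ENNReal.ofReal K + M, hmove, hfactor,
    ENNReal.add_ne_top.2 ⟨ENNReal.ofReal_ne_top, hMtop⟩, hcost, Or.inl hcross⟩

/-- Convergence of times to a positive time, together with convergence of lengths to infinity. -/
structure TimeConv (τ : ℕ → ℝ) (N : ℕ → ℕ) (t : ℝ) : Prop where
  size : Tendsto N atTop atTop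
  mem : ∀ k, τ k ∈ Set.Icc (0 : ℝ) 1
  time : Tendsto τ atTop (𝓝 t)
  pos : 0 < t
  le_one : t ≤ 1

/-- `TimeConv` as a relation on the parameters of the process. -/
def ProcessConv (σ : ℕ → ℝ × ℕ∞) (s : ℝ × ℕ∞) : Prop :=
  ∃ τ N t, TimeConv τ N t ∧ (∀ k, σ k = (τ k, (N k : ℕ∞))) ∧ s = (t, ⊤)

/-! ### Joint convergence of times and lengths -/

section convergence

variable {τ : ℕ → ℝ} {N : ℕ → ℕ} {t x : ℝ}

theorem TimeConv.tendsto_floor_div (h : TimeConv τ N t) :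
    Tendsto (fun k => (⌊(N k : ℝ) * τ k⌋₊ / N k : ℝ)) atTop (𝓝 t) := by
  have hlow : Tendsto (fun k => τ k - 1 / N k) atTop (𝓝 t) := by
    have := h.time.sub (tendsto_one_div_nat h.size)
    simpa using this
  refine tendsto_of_tendsto_of_tendsto_of_le_of_le' hlow h.time ?_ ?_
  · filter_upwards [h.size.eventually_ne_atTop 0] with k hk
    have hk' : (0 : ℝ) < N k := by positivity
    have := Nat.lt_floor_add_one ((N k : ℝ) * τ k)
    rw [le_div_iff₀ hk', sub_mul, one_div, inv_mul_cancel₀ hk'.ne']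
    linarith
  · filter_upwards [h.size.eventually_ne_atTop 0] with k hk
    have hk' : (0 : ℝ) < N k := by positivity
    have := Nat.floor_le (mul_nonneg hk'.le (h.mem k).1)
    rw [div_le_iff₀ hk']
    linarith

theorem TimeConv.tendsto_pivotSplit (h : TimeConv τ N t) (hx : x ∈ Set.Ioo (0 : ℝ) 1) :
    Tendsto (fun k => pivotSplit (fun _ => x) [] (N k)) atTop (𝓝 x) :=
  tendsto_pivotRank_div (u := fun _ => x) (v := []) hx h.size

theorem tendsto_left_div' (hx : x ∈ Set.Ioo (0 : ℝ) 1) (hN : Tendsto N atTop atTop) :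
    Tendsto (fun k => ((pivotRank (fun _ => x) [] (N k) : ℝ) - 1) / N k) atTop (𝓝 x) := by
  have h := (tendsto_pivotRank_div (u := fun _ => x) (v := []) hx hN).sub (tendsto_one_div_nat hN)
  rw [sub_zero] at h
  exact h.congr fun k => by rw [sub_div, Nat.cast_one]

theorem TimeConv.tendsto_timeFactor (h : TimeConv τ N t) (hx : x ∈ Set.Ioo (0 : ℝ) 1)
    (hxt : x ≠ t) (i : Fin 2) :
    Tendsto (fun k => timeFactor (fun _ => x) [] i (τ k) (N k)) atTop
      (𝓝 (timeFactor (fun _ => x) [] i t ⊤)) := by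
  have hsplit := h.tendsto_pivotSplit hx
  have hN := h.size.eventually_ne_atTop 0
  rcases lt_or_gt_of_ne hxt with hlt | hlt
  · have hev := hsplit.eventually_lt h.time hlt
    match i with
    | 0 =>
      have : timeFactor (fun _ => x) [] 0 t ⊤ = 0 := if_neg hlt.le.not_gt
      rw [this]
      refine tendsto_const_nhds.congr' ?_
      filter_upwards [hN, hev] with k hk hk'
      exact ((if_neg hk).trans (if_neg hk'.le.not_gt)).symm
    | 1 =>
      have : timeFactor (fun _ => x) [] 1 t ⊤ = 1 - x := if_pos hlt.le
      rw [this]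
      refine (hsplit.const_sub 1).congr' ?_
      filter_upwards [hN, hev] with k hk hk'
      exact ((if_neg hk).trans (if_pos hk'.le)).symm
  · have hev := h.time.eventually_lt hsplit hlt
    match i with
    | 0 =>
      have : timeFactor (fun _ => x) [] 0 t ⊤ = x := if_pos hlt
      rw [this]
      refine (tendsto_left_div' hx h.size).congr' ?_
      filter_upwards [hN, hev] with k hk hk'
      exact ((if_neg hk).trans (if_pos hk')).symm
    | 1 =>
      have : timeFactor (fun _ => x) [] 1 t ⊤ = 0 := if_neg hlt.not_ge
      rw [this]
      refine tendsto_const_nhds.congr' ?_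
      filter_upwards [hN, hev] with k hk hk'
      exact ((if_neg hk).trans (if_neg hk'.not_ge)).symm

theorem TimeConv.tendsto_splitWeight (h : TimeConv τ N t) (hx : x ∈ Set.Ioo (0 : ℝ) 1)
    (hxt : x ≠ t) :
    Tendsto (fun k => splitWeight (τ k) x (N k)) atTop (𝓝 (splitWeight t x ⊤)) := by
  have hsplit := h.tendsto_pivotSplit hx
  have hN := h.size.eventually_ne_atTop 0
  rcases lt_or_gt_of_ne hxt with hlt | hlt
  · have : splitWeight t x ⊤ = x := if_pos hlt.le
    rw [this]
    refine (tendsto_left_div' hx h.size).congr' ?_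
    filter_upwards [hN, hsplit.eventually_lt h.time hlt] with k hk hk'
    exact ((if_neg hk).trans (if_pos hk'.le)).symm
  · have : splitWeight t x ⊤ = 0 := if_neg hlt.not_ge
    rw [this]
    refine tendsto_const_nhds.congr' ?_
    filter_upwards [hN, h.time.eventually_lt hsplit hlt] with k hk hk'
    exact ((if_neg hk).trans (if_neg hk'.not_ge)).symm

theorem TimeConv.tendsto_timeTerm (h : TimeConv τ N t) (hx : x ∈ Set.Ioo (0 : ℝ) 1)
    (hxt : x ≠ t) : Tendsto (fun k => timeTerm (τ k) x (N k)) atTop (𝓝 (timeTerm t x ⊤)) := by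
  have := tendsto_timeCost h.size (eventually_pivotRank (u := fun _ => x) (v := []) hx h.size)
    (tendsto_pivotRank_div (u := fun _ => x) (v := []) hx h.size)
    (Eventually.of_forall fun k => floor_mul_le (h.mem k) (N k)) h.tendsto_floor_div h.pos hxt
  refine this.congr' ?_
  filter_upwards [h.size.eventually_ne_atTop 0] with k hk
  exact (if_neg hk).symm

/-- Numerator and denominator of the rescaled time are both divided by `N k`. The limit time stays
positive on either side of `x`, so no case distinction is needed. -/
theorem TimeConv.left (h : TimeConv τ N t) (hx : x ∈ Set.Ioo (0 : ℝ) 1) :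
    TimeConv (fun k => timeMove (fun _ => x) [] 0 (τ k) (N k))
      (fun k => pivotRank (fun _ => x) [] (N k) - 1) (timeMove (fun _ => x) [] 0 t ⊤) where
  size := tendsto_left (u := fun _ => x) (v := []) hx h.size
  mem k := timeMove_mem hx 0 (h.mem k) _
  time := by
    have h1 := h.tendsto_floor_div.div (tendsto_left_div' hx h.size) hx.1.ne'
    refine (Tendsto.min tendsto_const_nhds h1).congr' ?_
    filter_upwards [h.size.eventually_ne_atTop 0] with k hk
    have hk' : (N k : ℝ) ≠ 0 := by exact_mod_cast hk
    exact congrArg (min 1) (div_div_div_cancel_right₀ hk' _ _)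
  pos := lt_min one_pos (div_pos h.pos hx.1)
  le_one := min_le_left _ _

/-- The condition `x < t` is what keeps the limit time in the right sublist positive. -/
theorem TimeConv.right (h : TimeConv τ N t) (hx : x ∈ Set.Ioo (0 : ℝ) 1) (hxt : x < t) :
    TimeConv (fun k => timeMove (fun _ => x) [] 1 (τ k) (N k))
      (fun k => N k - pivotRank (fun _ => x) [] (N k)) (timeMove (fun _ => x) [] 1 t ⊤) where
  size := tendsto_right (u := fun _ => x) (v := []) hx h.size
  mem k := timeMove_mem hx 1 (h.mem k) _
  time := by
    have hsplit := h.tendsto_pivotSplit hx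
    exact Tendsto.max tendsto_const_nhds
      ((h.time.sub hsplit).div (hsplit.const_sub 1) (sub_pos.2 hx.2).ne')
  pos := lt_max_of_lt_right (div_pos (sub_pos.2 hxt) (sub_pos.2 hx.2))
  le_one := (timeMove_mem hx 1 ⟨h.pos.le, h.le_one⟩ ⊤).2

/-- The part depending on the root label alone converges by dominated convergence. The other part
is, given the root label, a convergent weight times the total cost of a left sublist whose length
tends to infinity, so the `L²` convergence of the total costs applies. The null event `x = t`, where
the indicators jump, is discarded. -/
theorem TimeConv.tendsto_cost (h : TimeConv τ N t) :
    Tendsto (fun k => eLpNorm (processScheme.cost (τ k, (N k : ℕ∞)) - processScheme.cost (t, ⊤)) 2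
      treeLaw) atTop (𝓝 0) := by
  have ht : t ∈ Set.Icc (0 : ℝ) 1 := ⟨h.pos.le, h.le_one⟩
  have hgood : ∀ᵐ x ∂unif, x ∈ Set.Ioo (0 : ℝ) 1 ∧ x ≠ t := ae_unif_mem_Ioo.and (ae_unif_ne t)
  obtain ⟨K, hK⟩ := exists_timeTerm_le
  obtain ⟨M, hMtop, hM⟩ := exists_totalSortCost_le
  let c : ℕ → ℝ → ℝ := fun k x => timeTerm (τ k) x (N k) - timeTerm t x ⊤
  have hcm : ∀ k, Measurable (c k) := fun k =>
    (measurable_timeTerm_right (τ k, (N k : ℕ∞))).sub (measurable_timeTerm_right (t, ⊤))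
  have hroot : Tendsto (fun k => eLpNorm (fun u : Vertex → ℝ => c k (u [])) 2 treeLaw)
      atTop (𝓝 0) := by
    refine tendsto_eLpNorm_root (K := K + K) hcm (fun k x hx => ?_) (hgood.mono fun x hx => ?_)
    · exact (abs_sub _ _).trans (add_le_add (hK _ (h.mem k) _ x hx) (hK t ht _ x hx))
    · simpa using (h.tendsto_timeTerm hx.1 hx.2).sub_const (timeTerm t x ⊤)
  let d : ℕ → (Vertex → ℝ) → ℝ := fun k => leftCost (τ k, (N k : ℕ∞)) - leftCost (t, ⊤)
  have hdm : ∀ k, Measurable (d k) := fun k =>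
    (measurable_leftCost_right _).sub (measurable_leftCost_right _)
  have hleft : Tendsto (fun k => eLpNorm (d k) 2 treeLaw) atTop (𝓝 0) := by
    refine tendsto_eLpNorm_of_node (M := M + M) hdm (by simp [hMtop]) (fun k => ?_) ?_
    · refine ae_unif_mem_Ioo.mono fun x hx => ?_
      refine (eLpNorm_sub_le
        ((measurable_leftCost_right _).comp (measurable_node_right x)).aestronglyMeasurable
        ((measurable_leftCost_right _).comp (measurable_node_right x)).aestronglyMeasurable
        one_le_two).trans (add_le_add ?_ ?_)
      · exact eLpNorm_leftCost_node_le hM _ hx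
      · exact eLpNorm_leftCost_node_le hM _ hx
    · refine hgood.mono fun x hx => ?_
      have hQ : Tendsto (fun k => eLpNorm (fun a =>
          splitWeight (τ k) x (N k) * sizeScheme.lim (sublistSize (fun _ => x) [] 0 (N k)) a -
            splitWeight t x ⊤ * sizeScheme.lim ⊤ a) 2 treeLaw) atTop (𝓝 0) :=
        tendsto_eLpNorm_mul_sub (fun k => sizeScheme.measurable_lim_right _)
          (sizeScheme.measurable_lim_right _) hMtop (fun k => hM _) (hM _)
          (h.tendsto_splitWeight hx.1 hx.2)
          (Or.inr (tendsto_totalSortCost (tendsto_left (u := fun _ => x) (v := []) hx.1 h.size)))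
      refine hQ.congr fun k => ?_
      refine (eLpNorm_comp_measurePreserving (ν := treeLaw) (μ := treeLaw.prod treeLaw)
        (f := Prod.fst) ?_ measurePreserving_fst).symm
      exact (((sizeScheme.measurable_lim_right _).const_mul _).sub
        ((sizeScheme.measurable_lim_right _).const_mul _)).aestronglyMeasurable
  have hsum := hroot.add hleft
  rw [add_zero] at hsum
  refine tendsto_of_tendsto_of_tendsto_of_le_of_le tendsto_const_nhds hsum
    (fun _ => zero_le) fun k => ?_
  have heq : processScheme.cost (τ k, (N k : ℕ∞)) - processScheme.cost (t, ⊤) =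
      (fun u : Vertex → ℝ => c k (u [])) + d k := by
    funext u
    simp only [processScheme, Pi.sub_apply, Pi.add_apply, c, d]
    ring
  dsimp only
  rw [heq]
  exact eLpNorm_add_le ((hcm k).comp (measurable_pi_apply _)).aestronglyMeasurable
    (hdm k).aestronglyMeasurable one_le_two

end convergence

theorem continuous_processScheme : processScheme.Continuous timeDomain ProcessConv where
  mem := by
    rintro σ s ⟨τ, N, t, h, hσ, rfl⟩
    exact ⟨⟨h.pos.le, h.le_one⟩, fun k => by rw [hσ]; exact h.mem k⟩
  factor := by
    rintro σ s ⟨τ, N, t, h, hσ, rfl⟩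
    filter_upwards [ae_unif_mem_Ioo, ae_unif_ne t] with x hx hxt i
    simp only [hσ]
    exact h.tendsto_timeFactor hx hxt i
  move := by
    rintro σ s ⟨τ, N, t, h, hσ, rfl⟩
    filter_upwards [ae_unif_mem_Ioo, ae_unif_ne t] with x hx hxt i
    simp only [hσ]
    match i with
    | 0 => exact Or.inr ⟨_, _, _, h.left hx, fun _ => rfl, rfl⟩
    | 1 =>
      rcases lt_or_gt_of_ne hxt with hlt | hlt
      · exact Or.inr ⟨_, _, _, h.right hx hlt, fun _ => rfl, rfl⟩
      -- For `t < x` the right sublist has limit time `0`, where continuity is not available, but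
      -- its limiting factor is zero.
      · exact Or.inl (if_neg hlt.not_ge)
  cost := by
    rintro σ s ⟨τ, N, t, h, hσ, rfl⟩
    simp only [hσ]
    exact h.tendsto_cost

theorem tendsto_lim_processScheme {t : ℝ} (ht : t ∈ Set.Ioc (0 : ℝ) 1) :
    Tendsto (fun n : ℕ => eLpNorm (processScheme.lim (t, (n : ℕ∞)) - processScheme.lim (t, ⊤)) 2
      treeLaw) atTop (𝓝 0) := by
  obtain ⟨κ, h⟩ := exists_contractive_processScheme
  have hconv : TimeConv (fun _ => t) (fun n => n) t :=
    ⟨tendsto_id, fun _ => ⟨ht.1.le, ht.2⟩, tendsto_const_nhds, ht.1, ht.2⟩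
  exact h.tendsto_lim continuous_processScheme (σ := fun n : ℕ => (t, (n : ℕ∞)))
    ⟨_, _, _, hconv, fun _ => rfl, rfl⟩

/-! ### Transfer to the given probability space -/

/-- The map `w ↦ v ++ w` is injective, so the labels below `v` are again independent and uniform;
every vertex is thereby reduced to the root of the canonical tree. -/
theorem measurePreserving_subtree {Ω : Type*} [MeasurableSpace Ω] {P : Measure Ω}
    {U : Vertex → Ω → ℝ} (hU_meas : ∀ v, Measurable (U v))
    (hU_unif : ∀ v, P.map (U v) = volume.restrict (Set.Icc (0 : ℝ) 1))
    (hU_indep : iIndepFun U P) (v : Vertex) :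
    MeasurePreserving (fun ω => subtree v fun w => U w ω) P treeLaw where
  measurable := measurable_pi_lambda _ fun w => hU_meas _
  map_eq := by
    have h := hU_indep.precomp (g := fun w : Vertex => v ++ w) fun _ _ h => List.append_cancel_left h
    refine (h.map_fun_eq_infinitePi_map fun w => hU_meas _).trans ?_
    simp only [hU_unif]
    rfl

end QuicksortProcess

theorem theorem4p8 {Ω : Type*} [MeasurableSpace Ω] (P : Measure Ω) [IsProbabilityMeasure P]
    (U : QuicksortProcess.Vertex → Ω → ℝ)
    (hU_meas : ∀ v, Measurable (U v))
    (hU_unif : ∀ v, P.map (U v) = volume.restrict (Set.Icc (0 : ℝ) 1))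
    (hU_indep : iIndepFun U P) :
    -- the limits that define `Q_n^v` and `Q^v` exist almost surely
    (∀ (v : QuicksortProcess.Vertex) (n : ℕ∞), ∀ᵐ ω ∂P,
      Tendsto (fun m : ℕ => QuicksortProcess.partialCost
          (QuicksortProcess.sizeWeight fun w => U w ω)
          (QuicksortProcess.sizeCost fun w => U w ω) m v n) atTop
        (𝓝 (QuicksortProcess.totalSortCost (fun w => U w ω) v n))) ∧
    ∀ (v : QuicksortProcess.Vertex) (t : ℝ), t ∈ Set.Ioc (0 : ℝ) 1 →
      -- the limits that define `Y_n^v(t)` and `Y^v(t)` exist almost surely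
      (∀ n : ℕ∞, ∀ᵐ ω ∂P,
        Tendsto (fun m : ℕ => QuicksortProcess.processPartial (fun w => U w ω) m v t n) atTop
          (𝓝 (QuicksortProcess.process (fun w => U w ω) v t n))) ∧
      -- and are square integrable
      (∀ n : ℕ∞, MemLp (fun ω => QuicksortProcess.process (fun w => U w ω) v t n) 2 P) ∧
      Tendsto (fun n : ℕ =>
        eLpNorm (fun ω => QuicksortProcess.process (fun w => U w ω) v t (n : ℕ∞)
          - QuicksortProcess.process (fun w => U w ω) v t ⊤) 2 P) atTop (𝓝 0) := by
  have hmp := QuicksortProcess.measurePreserving_subtree hU_meas hU_unif hU_indep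
  obtain ⟨_, hQ⟩ := QuicksortProcess.exists_contractive_sizeScheme
  obtain ⟨_, hY⟩ := QuicksortProcess.exists_contractive_processScheme
  refine ⟨fun v n => ?_, fun v t ht => ⟨fun n => ?_, fun n => ?_, ?_⟩⟩
  · simp only [QuicksortProcess.totalSortCost_eq, ← QuicksortProcess.weight_sizeScheme,
      ← QuicksortProcess.vertexCost_sizeScheme, QuicksortProcess.Scheme.partialCost_eq_psum]
    exact (hmp v).quasiMeasurePreserving.ae (hQ.ae_tendsto_lim (Set.mem_univ n))
  · simp only [QuicksortProcess.process_eq, QuicksortProcess.processPartial_eq]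
    exact (hmp v).quasiMeasurePreserving.ae
      (hY.ae_tendsto_lim (s := (t, n)) ⟨ht.1.le, ht.2⟩)
  · simp only [QuicksortProcess.process_eq]
    exact (hY.memLp_lim (s := (t, n)) ⟨ht.1.le, ht.2⟩).comp_measurePreserving (hmp v)
  · simp only [QuicksortProcess.process_eq]
    refine (QuicksortProcess.tendsto_lim_processScheme ht).congr fun n => ?_
    exact (eLpNorm_comp_measurePreserving
      ((QuicksortProcess.processScheme.measurable_lim_right _).sub
        (QuicksortProcess.processScheme.measurable_lim_right _)).aestronglyMeasurable (hmp v)).symm
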